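/- **Setting.** Let $X \neq \emptyset$ be countable and let $b : X\times X\to[0,\infty)$ satisfy $b(x,x)=0$, $b(x,y)=b(y,x)$ and $\sum_{z\in X} b(x,z)<\infty$ for all $x,y\in X$ (the graph need not be locally finite). Let $\mu:X\to(0,\infty)$ and $V:X\to\mathbb R$. All functions are real-valued; $C_c(X)$ denotes the finitely supported functions, and $\ell^2(X,\mu)$ is the Hilbert space of functions with $\sum_x f(x)^2\mu(x)<\infty$, with inner product $\langle f,g\rangle=\sum_x f(x)g(x)\mu(x)$. The formal Schrödinger operator is $$\mathcal H f(x)=\frac1{\mu(x)}\sum_{y\in X} b(x,y)\,(f(x)-f(y))+V(x)f(x),$$ defined for $f\in\mathcal F=\{f:X\to\mathbb R \mid \sum_y b(x,y)|f(y)|<\infty \text{ for all } x\in X\}$. Let $\mathcal D$ be the set of $f:X\to\mathbb R$ with $\sum_{x,y}b(x,y)(f(x)-f(y))^2+\sum_x|V(x)|f(x)^2\mu(x)<\infty$, and for $f,g\in\mathcal D$ let $$\mathcal Q(f,g)=\frac12\sum_{x,y\in X}b(x,y)(f(x)-f(y))(g(x)-g(y))+\sum_{x\in X}V(x)f(x)g(x)\mu(x).$$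 Let $\mathcal Q^c$ be the restriction of $\mathcal Q$ to $C_c(X)$, and let $Q^{(N)}$ be the restriction of $\mathcal Q$ to $\mathcal D\cap\ell^2(X,\mu)$. Quadratic forms $q$ on $\ell^2(X,\mu)$ have a domain $D(q)$, a linear subspace; we write $q(f)=q(f,f)$. A form is *closed* if it is densely defined, lower semi-bounded and complete in its form norm; the *closure* of a form is its smallest closed extension (if it exists). For forms $p,q$, we write $p\le q$ if $D(p)\subseteq D(q)$ and $p(f)\ge q(f)$ for all $f\in D(p)$, and $q$ *extends* $p$ if $D(p)\subseteq D(q)$ and $p=q$ on $D(p)$. The operator *associated* with a closed form $q$ is the self-adjoint operator $L$ such that $f\in D(L)$ and $Lf=g$ if and only if $f\in D(q)$ and $q(f,h)=\langle g,h\rangle$ for all $h\in D(q)$; $q$ is then called the quadratic form of $L$. A *Dirichlet form* is a closed nonnegative form $q$ such that $C\circ f\in D(q)$ and $q(C\circ f)\le q(f)$ for every $f\in D(q)$ and every $C:\mathbb R\to\mathbb R$ with $C(0)=0$ and $|C(s)-C(t)|\le|s-t|$. A self-adjoint operator $H$ on $\ell^2(X,\mu)$ is a *realization* of $\mathcal H$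 if it is lower semi-bounded, the domain of its quadratic form contains $C_c(X)$, $D(H)\subseteq\mathcal F$, and $Hf=\mathcal Hf$ for all $f\in D(H)$. It is *Markovian* if its quadratic form is a Dirichlet form. **Theorem (structure of Markovian realizations).** Let $H$ be a Markovian realization of $\mathcal H$ with associated Dirichlet form $Q$. Then $V\ge0$, the form $\mathcal Q^c$ has a closure $Q^0$ on $\ell^2(X,\mu)$, and $$Q^0\le Q\le Q^{(N)}.$$ Moreover, $Q$ is an extension of $Q^0$. -/

import Mathlib

noncomputable section

namespace DiscSchr

/-! ### Quadratic forms on a real Hilbert space -/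

section Forms

variable {E : Type*} [NormedAddCommGroup E] [InnerProductSpace ℝ E]

/-- A (real) quadratic form on `E`: a subspace `D(q)`, the domain, together with a symmetric
bilinear form on it. Its quadratic functional is `f ↦ q(f, f)` on `D(q)` and `∞` outside `D(q)`. -/
structure QForm (E : Type*) [NormedAddCommGroup E] [InnerProductSpace ℝ E] where
  /-- the domain `D(q)` -/
  domain : Submodule ℝ E
  /-- the bilinear form `q(f, g)` on `D(q)` -/
  form : LinearMap.BilinForm ℝ domain
  /-- symmetry -/
  symm : ∀ f g : domain, form f g = form g f

namespace QForm

/-- The value `q(f) = q(f, f)` for `f ∈ D(q)`. -/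
def val (q : QForm E) (f : q.domain) : ℝ := q.form f f

/-- `q.Extends p`: the form `q` is an extension of the form `p`. -/
def Extends (q p : QForm E) : Prop :=
  ∃ h : p.domain ≤ q.domain, ∀ f : p.domain, q.val ⟨f, h f.2⟩ = p.val f

/-- The form order: `p ≤ q` iff `D(p) ⊆ D(q)` and `p(f) ≥ q(f)` for all `f ∈ D(p)`. Larger forms
have larger domains and smaller values. -/
instance : LE (QForm E) where
  le p q := ∃ h : p.domain ≤ q.domain, ∀ f : p.domain, q.val ⟨f, h f.2⟩ ≤ p.val f

/-- `q` is lower semi-bounded. -/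
def LowerSemibounded (q : QForm E) : Prop :=
  ∃ C : ℝ, ∀ f : q.domain, C * ‖(f : E)‖ ^ 2 ≤ q.val f

/-- `q` is nonnegative. -/
def Nonneg (q : QForm E) : Prop := ∀ f : q.domain, 0 ≤ q.val f

/-- `q` is complete with respect to its form norm: if `u n → f` in `E` and
`q(u m - u n) → 0`, then `f ∈ D(q)` and `q(u n - f) → 0`. For a lower semi-bounded form `q` on a
Hilbert space this says that `D(q)` with the form inner product
`q(f, g) + c ⟪f, g⟫` (`c` large) is a Hilbert space. -/
def FormComplete (q : QForm E) : Prop :=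
  ∀ (u : ℕ → q.domain) (f : E),
    Filter.Tendsto (fun n => (u n : E)) Filter.atTop (nhds f) →
    Filter.Tendsto (fun mn : ℕ × ℕ => q.val (u mn.1 - u mn.2)) Filter.atTop (nhds 0) →
    ∃ hf : f ∈ q.domain,
      Filter.Tendsto (fun n => q.val (u n - ⟨f, hf⟩)) Filter.atTop (nhds 0)

/-- A closed form: densely defined, lower semi-bounded and complete in the form norm. -/
structure Closed (q : QForm E) : Prop where
  dense : Dense (q.domain : Set E)
  lowerSemibounded : q.LowerSemibounded
  complete : q.FormComplete

/-- `q₀` is the closure of `p`, i.e. the smallest closed extension of `p`. -/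
structure IsClosureOf (q₀ p : QForm E) : Prop where
  closed : q₀.Closed
  ext : q₀.Extends p
  least : ∀ q : QForm E, q.Closed → q.Extends p → q.Extends q₀

/-- `q` is the (closed) quadratic form of the operator `L`, i.e. `q` is closed and `L` is the
operator associated with `q`: `f ∈ D(L)` and `L f = g` iff `f ∈ D(q)` and `q(f, h) = ⟪g, h⟫` for all
`h ∈ D(q)`. -/
structure IsFormOf (q : QForm E) (L : E →ₗ.[ℝ] E) : Prop where
  closed : q.Closed
  mem_graph_iff : ∀ f g : E, (f, g) ∈ L.graph ↔
    ∃ hf : f ∈ q.domain, ∀ h : q.domain, q.form ⟨f, hf⟩ h = inner ℝ g (h : E)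

/-- The restriction of a form to a subspace of its domain. -/
def restrict (q : QForm E) (S : Submodule ℝ E) (hS : S ≤ q.domain) : QForm E where
  domain := S
  form := q.form.compl₁₂ (Submodule.inclusion hS) (Submodule.inclusion hS)
  symm _ _ := q.symm _ _

end QForm

end Forms

/-! ### Weighted graphs and the space `ℓ²(X, μ)` -/

/-- A symmetric weighted graph over the vertex set `X`. -/
structure WeightedGraph (X : Type*) where
  /-- the edge weight -/
  b : X → X → ℝ
  nonneg : ∀ x y, 0 ≤ b x y
  diag : ∀ x, b x x = 0
  symm : ∀ x y, b x y = b y x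
  summable : ∀ x, Summable (b x)

/-- A weight: a strictly positive function on `X`. -/
structure Weight (X : Type*) where
  /-- the underlying function -/
  w : X → ℝ
  pos : ∀ x, 0 < w x

instance {X : Type*} : CoeFun (Weight X) (fun _ => X → ℝ) := ⟨Weight.w⟩

section

variable {X : Type*}

/-- The real functions `f` with `∑ x, f(x)² μ(x) < ∞`. -/
def ellTwoSubmodule (μ : Weight X) : Submodule ℝ (X → ℝ) where
  carrier := {f | Summable fun x => f x ^ 2 * μ x}
  zero_mem' := by simp [summable_zero]
  add_mem' := by
    intro f g hf hg
    refine Summable.of_nonneg_of_le (fun x => mul_nonneg (sq_nonneg _) (μ.pos x).le)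
      (fun x => ?_) ((hf.mul_left 2).add (hg.mul_left 2))
    have := (μ.pos x).le
    simp only [Pi.add_apply]
    nlinarith [mul_nonneg (sq_nonneg (f x - g x)) this]
  smul_mem' := by
    intro c f hf
    refine (hf.mul_left (c ^ 2)).congr (fun x => ?_)
    simp only [Pi.smul_apply, smul_eq_mul]
    ring

/-- The real Hilbert space `ℓ²(X, μ)`. -/
def EllTwo (μ : Weight X) : Type _ := ellTwoSubmodule μ

namespace EllTwo

variable {μ : Weight X}

instance : AddCommGroup (EllTwo μ) := inferInstanceAs (AddCommGroup (ellTwoSubmodule μ))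

instance : Module ℝ (EllTwo μ) := inferInstanceAs (Module ℝ (ellTwoSubmodule μ))

/-- The inclusion of `ℓ²(X, μ)` into the space of all functions. -/
def toFunₗ (μ : Weight X) : EllTwo μ →ₗ[ℝ] (X → ℝ) := (ellTwoSubmodule μ).subtype

instance : CoeFun (EllTwo μ) (fun _ => X → ℝ) := ⟨fun f => toFunₗ μ f⟩

/-- The element of `ℓ²(X, μ)` given by a square summable function. -/
def mk (f : X → ℝ) (hf : Summable fun x => f x ^ 2 * μ x) : EllTwo μ := ⟨f, hf⟩

@[simp] theorem mk_apply (f : X → ℝ) (hf : Summable fun x => f x ^ 2 * μ x) (x : X) :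
    (mk f hf : EllTwo μ) x = f x := rfl

theorem add_apply (f g : EllTwo μ) (x : X) : (f + g) x = f x + g x := rfl

theorem smul_apply (c : ℝ) (f : EllTwo μ) (x : X) : (c • f) x = c * f x := rfl

theorem ext {f g : EllTwo μ} (h : ∀ x, f x = g x) : f = g := Subtype.ext (funext h)

theorem summable_sq (f : EllTwo μ) : Summable fun x => f x ^ 2 * μ x := f.2

theorem summable_mul (f g : EllTwo μ) : Summable fun x => f x * g x * μ x := by
  refine Summable.of_norm_bounded (f.summable_sq.add g.summable_sq) (fun x => ?_)
  have hμ := (μ.pos x).le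
  rw [Real.norm_eq_abs, abs_mul, abs_of_nonneg hμ, abs_mul]
  nlinarith [mul_nonneg (sq_nonneg (|f x| - |g x|)) hμ, sq_abs (f x), sq_abs (g x),
    mul_nonneg (mul_nonneg (abs_nonneg (f x)) (abs_nonneg (g x))) hμ]

/-- The inner product `⟪f, g⟫ = ∑ x, f(x) g(x) μ(x)`. -/
@[reducible]
def core (μ : Weight X) : InnerProductSpace.Core ℝ (EllTwo μ) where
  inner f g := ∑' x, f x * g x * μ x
  conj_inner_symm f g := by
    simp only [conj_trivial]
    exact tsum_congr fun x => by ring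
  re_inner_nonneg f := by
    simp only [RCLike.re_to_real]
    exact tsum_nonneg fun x => mul_nonneg (mul_self_nonneg _) (μ.pos x).le
  add_left f g h := by
    rw [← (summable_mul f h).tsum_add (summable_mul g h)]
    exact tsum_congr fun x => by rw [add_apply]; ring
  smul_left f g c := by
    simp only [conj_trivial]
    rw [← tsum_mul_left]
    exact tsum_congr fun x => by rw [smul_apply]; ring
  definite f h := by
    have h0 : ∀ x, 0 ≤ f x * f x * μ x := fun x => mul_nonneg (mul_self_nonneg _) (μ.pos x).le
    have := ((summable_mul f f).hasSum_iff.2 h)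
    have h1 := (hasSum_zero_iff_of_nonneg h0).1 this
    refine ext fun x => ?_
    have h2 := congrFun h1 x
    simp only [Pi.zero_apply, mul_eq_zero, (μ.pos x).ne', or_false, or_self] at h2
    exact h2

instance : NormedAddCommGroup (EllTwo μ) := (core μ).toNormedAddCommGroup

instance : InnerProductSpace ℝ (EllTwo μ) := InnerProductSpace.ofCore (core μ).toCore

theorem inner_def (f g : EllTwo μ) : inner ℝ f g = ∑' x, f x * g x * μ x := rfl

theorem norm_sq_eq (f : EllTwo μ) : ‖f‖ ^ 2 = ∑' x, f x ^ 2 * μ x := by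
  rw [← real_inner_self_eq_norm_sq, inner_def]
  exact tsum_congr fun x => by ring

theorem summable_iff_memlp (f : X → ℝ) :
    (Summable fun x => f x ^ 2 * μ x) ↔ Memℓp (fun x => Real.sqrt (μ x) * f x) 2 := by
  rw [memℓp_gen_iff (by norm_num)]
  refine summable_congr fun x => ?_
  have := Real.sq_sqrt (μ.pos x).le
  simp only [ENNReal.toReal_ofNat, Real.rpow_ofNat, Real.norm_eq_abs, sq_abs]
  rw [mul_pow, this]
  ring

/-- The unitary map `f ↦ √μ f` onto the unweighted space, used to see completeness. -/
def toUnweighted (μ : Weight X) : EllTwo μ ≃ₗᵢ[ℝ] lp (fun _ : X => ℝ) 2 where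
  toFun f := ⟨fun x => Real.sqrt (μ x) * f x, (summable_iff_memlp _).1 f.summable_sq⟩
  invFun g := mk (fun x => (Real.sqrt (μ x))⁻¹ * g x) (by
    rw [summable_iff_memlp]
    have h : (fun x => Real.sqrt (μ x) * ((Real.sqrt (μ x))⁻¹ * g x)) = g := funext fun x =>
      mul_inv_cancel_left₀ (Real.sqrt_pos.2 (μ.pos x)).ne' _
    rw [h]
    exact g.2)
  left_inv f := by
    refine ext fun x => ?_
    have : Real.sqrt (μ x) ≠ 0 := (Real.sqrt_pos.2 (μ.pos x)).ne'
    simp [this]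
  right_inv g := by
    refine lp.ext (funext fun x => ?_)
    have : Real.sqrt (μ x) ≠ 0 := (Real.sqrt_pos.2 (μ.pos x)).ne'
    simp [this]
  map_add' f g := by
    refine lp.ext (funext fun x => ?_)
    exact (congrArg (Real.sqrt (μ x) * ·) (add_apply f g x)).trans (mul_add _ _ _)
  map_smul' c f := by
    refine lp.ext (funext fun x => ?_)
    simp only [smul_apply, RingHom.id_apply, lp.coeFn_smul, Pi.smul_apply, smul_eq_mul]
    ring
  norm_map' f := by
    rw [← sq_eq_sq₀ (norm_nonneg _) (norm_nonneg _), norm_sq_eq]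
    have := lp.norm_rpow_eq_tsum (p := 2) (by norm_num)
      (⟨fun x => Real.sqrt (μ x) * f x, (summable_iff_memlp _).1 f.summable_sq⟩ :
        lp (fun _ : X => ℝ) 2)
    simp only [ENNReal.toReal_ofNat, Real.rpow_ofNat] at this
    refine this.trans (tsum_congr fun x => ?_)
    simp only [Real.norm_eq_abs, sq_abs]
    rw [mul_pow, Real.sq_sqrt (μ.pos x).le]
    ring

instance : CompleteSpace (EllTwo μ) :=
  (toUnweighted μ).toIsometryEquiv.completeSpace

end EllTwo

/-! ### Dirichlet forms -/

/-- `C : ℝ → ℝ` is a normal contraction. -/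
structure NormalContraction (C : ℝ → ℝ) : Prop where
  map_zero : C 0 = 0
  contr : ∀ s t, |C s - C t| ≤ |s - t|

/-- The composition `C ∘ f ∈ ℓ²(X, μ)` of `f ∈ ℓ²(X, μ)` with a normal contraction. -/
def NormalContraction.comp {C : ℝ → ℝ} (hC : NormalContraction C) {μ : Weight X}
    (f : EllTwo μ) : EllTwo μ :=
  EllTwo.mk (fun x => C (f x)) (by
    refine Summable.of_nonneg_of_le (fun x => mul_nonneg (sq_nonneg _) (μ.pos x).le)
      (fun x => mul_le_mul_of_nonneg_right ?_ (μ.pos x).le) f.summable_sq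
    have := hC.contr (f x) 0
    rw [hC.map_zero, sub_zero, sub_zero] at this
    exact sq_le_sq.2 this)

/-- A Dirichlet form on `ℓ²(X, μ)`: a closed nonnegative quadratic form `q` such that `C ∘ f ∈ D(q)`
and `q(C ∘ f) ≤ q(f)` for all `f ∈ D(q)` and all normal contractions `C`. -/
structure IsDirichletForm {μ : Weight X} (q : QForm (EllTwo μ)) : Prop where
  closed : q.Closed
  nonneg : q.Nonneg
  contraction : ∀ (C : ℝ → ℝ) (hC : NormalContraction C) (f : q.domain),
    ∃ h : hC.comp (f : EllTwo μ) ∈ q.domain, q.val ⟨hC.comp (f : EllTwo μ), h⟩ ≤ q.val f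

/-- `C_c(X)` as a subspace of `ℓ²(X, μ)`: the functions of finite support. -/
def finSupp (μ : Weight X) : Submodule ℝ (EllTwo μ) where
  carrier := {f | (Function.support f).Finite}
  zero_mem' := by
    have : Function.support ((0 : EllTwo μ) : X → ℝ) = ∅ := by simp
    exact Set.finite_empty.subset this.subset
  add_mem' := by
    intro f g hf hg
    exact (hf.union hg).subset (Function.support_add (f : X → ℝ) (g : X → ℝ))
  smul_mem' := by
    intro c f hf
    exact hf.subset (Function.support_const_smul_subset c (f : X → ℝ))

/-! ### The formal Schrödinger operator and its realizations -/

/-- The domain `𝓕` of the formal Schrödinger operator. -/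
def formalDomain (G : WeightedGraph X) : Set (X → ℝ) :=
  {f | ∀ x, Summable fun y => G.b x y * |f y|}

/-- The formal Schrödinger operator
`𝓗 f(x) = μ(x)⁻¹ ∑ y, b(x, y) (f(x) - f(y)) + V(x) f(x)`, for `f ∈ 𝓕`. -/
def formalOp (G : WeightedGraph X) (μ : Weight X) (V : X → ℝ) (f : X → ℝ) (x : X) : ℝ :=
  (μ x)⁻¹ * ∑' y, G.b x y * (f x - f y) + V x * f x

/-- A self-adjoint operator `H` on `ℓ²(X, μ)` is a realization of `𝓗` if it is lower semi-bounded,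
if the domain of its quadratic form contains `C_c(X)`, and if `D(H) ⊆ 𝓕` with `H f = 𝓗 f` for
all `f ∈ D(H)`. -/
structure IsRealization (G : WeightedGraph X) (μ : Weight X) (V : X → ℝ)
    (H : EllTwo μ →ₗ.[ℝ] EllTwo μ) : Prop where
  selfAdjoint : IsSelfAdjoint H
  lowerSemibounded : ∃ C : ℝ, ∀ f : H.domain,
    C * ‖(f : EllTwo μ)‖ ^ 2 ≤ inner ℝ (f : EllTwo μ) (H f)
  finSupp_le : ∃ q : QForm (EllTwo μ), q.IsFormOf H ∧ finSupp μ ≤ q.domain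
  mem_formalDomain : ∀ f : H.domain, ((f : EllTwo μ) : X → ℝ) ∈ formalDomain G
  apply_eq : ∀ (f : H.domain) (x : X), (H f) x = formalOp G μ V (f : EllTwo μ) x

/-- `H` is a Markovian realization of `𝓗` and `Q` is its quadratic form, a Dirichlet form. -/
structure IsMarkovianRealization (G : WeightedGraph X) (μ : Weight X) (V : X → ℝ)
    (H : EllTwo μ →ₗ.[ℝ] EllTwo μ) (Q : QForm (EllTwo μ)) : Prop where
  realization : IsRealization G μ V H
  isFormOf : Q.IsFormOf H
  dirichlet : IsDirichletForm Q

/-! ### Schrödinger forms -/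

/-- The space `𝓓` of functions of finite energy. -/
def finiteEnergy (G : WeightedGraph X) (μ : Weight X) (V : X → ℝ) : Submodule ℝ (X → ℝ) where
  carrier := {f | (Summable fun p : X × X => G.b p.1 p.2 * (f p.1 - f p.2) ^ 2) ∧
    Summable fun x => |V x| * f x ^ 2 * μ x}
  zero_mem' := by simp [summable_zero]
  add_mem' := by
    rintro f g ⟨hf, hf'⟩ ⟨hg, hg'⟩
    constructor
    · refine Summable.of_nonneg_of_le (fun p => mul_nonneg (G.nonneg _ _) (sq_nonneg _))
        (fun p => ?_) ((hf.mul_left 2).add (hg.mul_left 2))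
      simp only [Pi.add_apply]
      nlinarith [mul_nonneg (G.nonneg p.1 p.2) (sq_nonneg ((f p.1 - f p.2) - (g p.1 - g p.2)))]
    · refine Summable.of_nonneg_of_le
        (fun x => mul_nonneg (mul_nonneg (abs_nonneg _) (sq_nonneg _)) (μ.pos x).le)
        (fun x => ?_) ((hf'.mul_left 2).add (hg'.mul_left 2))
      simp only [Pi.add_apply]
      nlinarith [mul_nonneg (mul_nonneg (abs_nonneg (V x)) (sq_nonneg (f x - g x))) (μ.pos x).le]
  smul_mem' := by
    rintro c f ⟨hf, hf'⟩
    refine ⟨(hf.mul_left (c ^ 2)).congr fun p => ?_, (hf'.mul_left (c ^ 2)).congr fun x => ?_⟩ <;>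
    · simp only [Pi.smul_apply, smul_eq_mul]
      ring

theorem summable_energy {G : WeightedGraph X} {μ : Weight X} {V : X → ℝ} {f g : X → ℝ}
    (hf : f ∈ finiteEnergy G μ V) (hg : g ∈ finiteEnergy G μ V) :
    Summable fun p : X × X => G.b p.1 p.2 * (f p.1 - f p.2) * (g p.1 - g p.2) := by
  refine Summable.of_norm_bounded (hf.1.add hg.1) (fun p => ?_)
  have hb := G.nonneg p.1 p.2
  rw [Real.norm_eq_abs, abs_mul, abs_mul, abs_of_nonneg hb]
  nlinarith [mul_nonneg hb (sq_nonneg (|f p.1 - f p.2| - |g p.1 - g p.2|)),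
    sq_abs (f p.1 - f p.2), sq_abs (g p.1 - g p.2),
    mul_nonneg hb (mul_nonneg (abs_nonneg (f p.1 - f p.2)) (abs_nonneg (g p.1 - g p.2)))]

theorem summable_potential {G : WeightedGraph X} {μ : Weight X} {V : X → ℝ} {f g : X → ℝ}
    (hf : f ∈ finiteEnergy G μ V) (hg : g ∈ finiteEnergy G μ V) :
    Summable fun x => V x * f x * g x * μ x := by
  refine Summable.of_norm_bounded (hf.2.add hg.2) (fun x => ?_)
  have hb := mul_nonneg (abs_nonneg (V x)) (μ.pos x).le
  rw [Real.norm_eq_abs, abs_mul, abs_mul, abs_mul, abs_of_nonneg (μ.pos x).le]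
  nlinarith [mul_nonneg hb (sq_nonneg (|f x| - |g x|)), sq_abs (f x), sq_abs (g x),
    mul_nonneg hb (mul_nonneg (abs_nonneg (f x)) (abs_nonneg (g x)))]

/-- The Schrödinger form on `𝓓`,
`𝓠(f, g) = ½ ∑ (x, y), b(x, y) (f(x) - f(y)) (g(x) - g(y)) + ∑ x, V(x) f(x) g(x) μ(x)`. -/
def energyForm (G : WeightedGraph X) (μ : Weight X) (V : X → ℝ) :
    LinearMap.BilinForm ℝ (finiteEnergy G μ V) :=
  LinearMap.mk₂ ℝ
    (fun f g => 1 / 2 * ∑' p : X × X,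
        G.b p.1 p.2 * (f.1 p.1 - f.1 p.2) * (g.1 p.1 - g.1 p.2)
      + ∑' x, V x * f.1 x * g.1 x * μ x)
    (by
      intro f f' g
      have h1 := (summable_energy f.2 g.2).tsum_add (summable_energy f'.2 g.2)
      have h2 := (summable_potential f.2 g.2).tsum_add (summable_potential f'.2 g.2)
      rw [add_add_add_comm, ← mul_add, ← h1, ← h2]
      congr 2
      · exact tsum_congr fun p => by simp only [Submodule.coe_add, Pi.add_apply]; ring
      · exact funext fun x => by simp only [Submodule.coe_add, Pi.add_apply]; ring)
    (by
      intro c f g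
      simp only [Submodule.coe_smul, Pi.smul_apply, smul_eq_mul]
      rw [mul_add, mul_left_comm, ← tsum_mul_left (a := c), ← tsum_mul_left (a := c)]
      congr 1
      · congr 1
        exact tsum_congr fun p => by ring
      · exact tsum_congr fun x => by ring)
    (by
      intro f g g'
      have h1 := (summable_energy f.2 g.2).tsum_add (summable_energy f.2 g'.2)
      have h2 := (summable_potential f.2 g.2).tsum_add (summable_potential f.2 g'.2)
      rw [add_add_add_comm, ← mul_add, ← h1, ← h2]
      congr 2
      · exact tsum_congr fun p => by simp only [Submodule.coe_add, Pi.add_apply]; ring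
      · exact funext fun x => by simp only [Submodule.coe_add, Pi.add_apply]; ring)
    (by
      intro c f g
      simp only [Submodule.coe_smul, Pi.smul_apply, smul_eq_mul]
      rw [mul_add, mul_left_comm, ← tsum_mul_left (a := c), ← tsum_mul_left (a := c)]
      congr 1
      · congr 1
        exact tsum_congr fun p => by ring
      · exact tsum_congr fun x => by ring)

/-- The form `Q^(N)`: the restriction of `𝓠` to `𝓓 ∩ ℓ²(X, μ)`. -/
def neumannForm (G : WeightedGraph X) (μ : Weight X) (V : X → ℝ) : QForm (EllTwo μ) where
  domain := (finiteEnergy G μ V).comap (EllTwo.toFunₗ μ)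
  form := (energyForm G μ V).compl₁₂
    ((EllTwo.toFunₗ μ).restrict (fun _ hf => hf)) ((EllTwo.toFunₗ μ).restrict (fun _ hf => hf))
  symm f g := by
    simp only [LinearMap.compl₁₂_apply, energyForm, LinearMap.mk₂_apply]
    congr 2
    · exact tsum_congr fun p => by ring
    · exact funext fun x => by ring

theorem mem_finiteEnergy_of_finite_support (G : WeightedGraph X) (μ : Weight X) (V : X → ℝ)
    (f : X → ℝ) (hf : (Function.support f).Finite) : f ∈ finiteEnergy G μ V := by
  have hz : ∀ x ∉ hf.toFinset, f x = 0 := fun x hx => by simpa using hx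
  refine ⟨?_, summable_of_ne_finset_zero (s := hf.toFinset) fun x hx => by simp [hz x hx]⟩
  have key : Summable fun p : X × X => G.b p.1 p.2 * f p.1 ^ 2 := by
    have h0 : Summable fun x => ∑' y, G.b x y * f x ^ 2 :=
      summable_of_ne_finset_zero (s := hf.toFinset) fun x hx => by
        rw [hz x hx]
        simp
    have h1 : 0 ≤ fun p : X × X => G.b p.1 p.2 * f p.1 ^ 2 :=
      fun p => mul_nonneg (G.nonneg p.1 p.2) (sq_nonneg (f p.1))
    have h2 : ∀ x, Summable fun y => G.b x y * f x ^ 2 :=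
      fun x => (G.summable x).mul_right (f x ^ 2)
    exact (summable_prod_of_nonneg h1).2 ⟨h2, h0⟩
  have key' : Summable fun p : X × X => G.b p.1 p.2 * f p.2 ^ 2 := by
    refine ((Equiv.prodComm X X).summable_iff.2 key).congr fun p => ?_
    simp [G.symm p.2 p.1]
  refine Summable.of_nonneg_of_le (fun p => mul_nonneg (G.nonneg _ _) (sq_nonneg _))
    (fun p => ?_) ((key.mul_left 2).add (key'.mul_left 2))
  nlinarith [mul_nonneg (G.nonneg p.1 p.2) (sq_nonneg (f p.1 + f p.2))]

theorem finSupp_le_neumannForm (G : WeightedGraph X) (μ : Weight X) (V : X → ℝ) :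
    finSupp μ ≤ (neumannForm G μ V).domain :=
  fun f hf => mem_finiteEnergy_of_finite_support G μ V f hf

/-- The form `𝓠^c`: the restriction of `𝓠` to `C_c(X)`. -/
def compactForm (G : WeightedGraph X) (μ : Weight X) (V : X → ℝ) : QForm (EllTwo μ) :=
  (neumannForm G μ V).restrict (finSupp μ) (finSupp_le_neumannForm G μ V)

end

end DiscSchr

end

/-! Everything runs through the resolvents `T = α (L + α)⁻¹` of `Q`. `T f` minimizes `k ↦ Q(k) + α
‖f - k‖²`, which gives at once `T f → f` in form norm as `α → ∞` (`tendsto_resolvent`) and, by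
clamping values, that `T` preserves functions with values in `[0, 1]` (`resolvent_mem_Icc`).

Since the graph need not be locally finite, `δ_x` need not lie in `D(H)`. But `T f ∈ D(H)`, so `H`
acts on it as the formal operator. If `f` has values in `[0, 1]`, so do the `T f`, and dominated
convergence against `b(x, ·)` yields `Q(f, δ_x) = μ(x) 𝓗 f(x)` (`form_delta`). Hence `Q` and `𝓠^c`
have the same matrix in the basis of point masses (`extends_compactForm`), and the closure of `𝓠^c`
is its form closure inside `Q` (`exists_isClosureOf`). Clamping `1_K + t δ_x` shows `Q(1_K, δ_x) ≥
0` for `x ∈ K`; letting `K` exhaust `X` gives `V(x) ≥ 0`.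

For `Q ≤ Q^(N)`, the approximating form `α ⟪f - T f, f⟫ ≤ Q(f)`, applied to finitely supported
functions, is itself a graph form with nonnegative edge weights and killing term. Its part on a
fixed finite set `L` is bounded below independently of the truncation, and the bound tends to the
Schrödinger energy on `L` as `α → ∞` (`sum_le_val`). Exhausting `X` by finite sets `L` finishes the
proof. -/

noncomputable section
namespace DiscSchr

/-! ### Nonnegative closed forms and their form Hilbert spaces. -/

namespace QForm

variable {E : Type*} [NormedAddCommGroup E] [InnerProductSpace ℝ E]

theorem val_add (q : QForm E) (f g : q.domain) :
    q.val (f + g) = q.val f + 2 * q.form f g + q.val g := by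
  simp only [val, map_add, LinearMap.add_apply]
  rw [q.symm g f]
  ring

theorem val_sub (q : QForm E) (f g : q.domain) :
    q.val (f - g) = q.val f - 2 * q.form f g + q.val g := by
  simp only [val, map_sub, LinearMap.sub_apply]
  rw [q.symm g f]
  ring

theorem val_smul (q : QForm E) (c : ℝ) (f : q.domain) : q.val (c • f) = c ^ 2 * q.val f := by
  simp only [val, map_smul, LinearMap.smul_apply, smul_eq_mul]
  ring

theorem form_sq_le (q : QForm E) (hn : q.Nonneg) (f g : q.domain) :
    q.form f g ^ 2 ≤ q.val f * q.val g := by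
  have h : ∀ t : ℝ, 0 ≤ q.val g * (t * t) + 2 * q.form f g * t + q.val f := by
    intro t
    have := hn (f + t • g)
    rw [val_add, val_smul, map_smul, smul_eq_mul] at this
    linarith
  have := discrim_le_zero h
  rw [discrim] at this
  nlinarith

/-- The domain of a closed nonnegative form, to be equipped with the inner product
`q(f, g) + α ⟪f, g⟫`. -/
@[nolint unusedArguments]
def FormSpace (q : QForm E) (_ : q.Closed) (_ : q.Nonneg) (α : ℝ) (_ : 0 < α) : Type _ :=
  q.domain

namespace FormSpace

variable {q : QForm E} {hc : q.Closed} {hn : q.Nonneg} {α : ℝ} {hα : 0 < α}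

instance : AddCommGroup (FormSpace q hc hn α hα) := inferInstanceAs (AddCommGroup q.domain)

instance : Module ℝ (FormSpace q hc hn α hα) := inferInstanceAs (Module ℝ q.domain)

/-- The identity from the form space to the domain of the form. -/
def toDomain (q : QForm E) (hc : q.Closed) (hn : q.Nonneg) (α : ℝ) (hα : 0 < α) :
    FormSpace q hc hn α hα ≃ₗ[ℝ] q.domain := LinearEquiv.refl ℝ q.domain

/-- The inner product `q(f, g) + α ⟪f, g⟫`. -/
@[reducible]
def core (q : QForm E) (hc : q.Closed) (hn : q.Nonneg) (α : ℝ) (hα : 0 < α) :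
    InnerProductSpace.Core ℝ (FormSpace q hc hn α hα) where
  inner f g := q.form (toDomain q hc hn α hα f) (toDomain q hc hn α hα g)
    + α * inner ℝ (toDomain q hc hn α hα f : E) (toDomain q hc hn α hα g : E)
  conj_inner_symm f g := by
    simp only [conj_trivial]
    rw [q.symm, real_inner_comm]
  re_inner_nonneg f := by
    simp only [RCLike.re_to_real]
    exact add_nonneg (hn _) (mul_nonneg hα.le real_inner_self_nonneg)
  add_left f g h := by
    simp only [map_add, LinearMap.add_apply, Submodule.coe_add, inner_add_left]
    ring
  smul_left f g c := by
    simp only [map_smul, LinearMap.smul_apply, Submodule.coe_smul, real_inner_smul_left,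
      smul_eq_mul, conj_trivial]
    ring
  definite f h := by
    have h1 : 0 ≤ q.form (toDomain q hc hn α hα f) (toDomain q hc hn α hα f) := hn _
    have h2 : 0 ≤ inner ℝ (toDomain q hc hn α hα f : E) (toDomain q hc hn α hα f : E) :=
      real_inner_self_nonneg
    have h3 : inner ℝ (toDomain q hc hn α hα f : E) (toDomain q hc hn α hα f : E) = 0 := by
      have := mul_nonneg hα.le h2
      have h4 : α * inner ℝ (toDomain q hc hn α hα f : E) (toDomain q hc hn α hα f : E) = 0 := by
        linarith
      exact (mul_eq_zero.1 h4).resolve_left hα.ne'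
    have h5 := inner_self_eq_zero.1 h3
    exact (toDomain q hc hn α hα).injective ((Subtype.ext h5).trans (map_zero _).symm)

instance : NormedAddCommGroup (FormSpace q hc hn α hα) :=
  (core q hc hn α hα).toNormedAddCommGroup

instance : InnerProductSpace ℝ (FormSpace q hc hn α hα) :=
  InnerProductSpace.ofCore (core q hc hn α hα).toCore

theorem inner_def (f g : FormSpace q hc hn α hα) :
    inner ℝ f g = q.form (toDomain q hc hn α hα f) (toDomain q hc hn α hα g)
      + α * inner ℝ (toDomain q hc hn α hα f : E) (toDomain q hc hn α hα g : E) := rfl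

theorem norm_sq_eq (f : FormSpace q hc hn α hα) :
    ‖f‖ ^ 2 = q.val (toDomain q hc hn α hα f) + α * ‖(toDomain q hc hn α hα f : E)‖ ^ 2 := by
  rw [← real_inner_self_eq_norm_sq, ← real_inner_self_eq_norm_sq, inner_def]
  rfl

/-- The embedding of the form space into the Hilbert space. -/
def embedding (q : QForm E) (hc : q.Closed) (hn : q.Nonneg) (α : ℝ) (hα : 0 < α) :
    FormSpace q hc hn α hα →L[ℝ] E :=
  LinearMap.mkContinuous (q.domain.subtype ∘ₗ (toDomain q hc hn α hα).toLinearMap)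
    (Real.sqrt α)⁻¹ (by
      intro f
      rw [inv_mul_eq_div, le_div_iff₀ (Real.sqrt_pos.2 hα)]
      refine abs_le_of_sq_le_sq' ?_ (norm_nonneg _) |>.2
      rw [mul_pow, Real.sq_sqrt hα.le, norm_sq_eq, mul_comm]
      exact le_add_of_nonneg_left (hn _))

theorem embedding_apply (f : FormSpace q hc hn α hα) :
    embedding q hc hn α hα f = (toDomain q hc hn α hα f : E) := rfl

/-- The form norm dominates both the norm of `E` and `q`, so a Cauchy sequence converges in `E`, and
closedness of `q` upgrades this to convergence in form norm. -/
instance [CompleteSpace E] : CompleteSpace (FormSpace q hc hn α hα) := by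
  refine Metric.complete_of_cauchySeq_tendsto fun u hu => ?_
  have h1 : CauchySeq fun n => embedding q hc hn α hα (u n) :=
    hu.map (embedding q hc hn α hα).uniformContinuous
  obtain ⟨f, hf⟩ := cauchySeq_tendsto_of_complete h1
  have h2 : Filter.Tendsto (fun mn : ℕ × ℕ => ‖u mn.1 - u mn.2‖ ^ 2) Filter.atTop (nhds 0) := by
    have := (cauchySeq_iff_tendsto_dist_atTop_0.1 hu).pow 2
    simpa [dist_eq_norm] using this
  have h3 : Filter.Tendsto (fun mn : ℕ × ℕ =>
      q.val (toDomain q hc hn α hα (u mn.1) - toDomain q hc hn α hα (u mn.2)))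
      Filter.atTop (nhds 0) := by
    refine squeeze_zero (fun _ => hn _) (fun mn => ?_) h2
    rw [norm_sq_eq, map_sub]
    exact le_add_of_nonneg_right (by positivity)
  obtain ⟨hfd, h4⟩ := hc.complete (fun n => toDomain q hc hn α hα (u n)) f hf h3
  refine ⟨(toDomain q hc hn α hα).symm ⟨f, hfd⟩, ?_⟩
  rw [tendsto_iff_norm_sub_tendsto_zero]
  have h5 : Filter.Tendsto (fun n => ‖u n - (toDomain q hc hn α hα).symm ⟨f, hfd⟩‖ ^ 2)
      Filter.atTop (nhds 0) := by
    have h6 := (tendsto_iff_norm_sub_tendsto_zero.1 hf).pow 2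
    have h7 := h4.add (h6.const_mul α)
    simp only [ne_eq, OfNat.ofNat_ne_zero, not_false_eq_true, zero_pow, mul_zero, add_zero] at h7
    refine h7.congr fun n => ?_
    rw [norm_sq_eq, map_sub, LinearEquiv.apply_symm_apply]
    rfl
  have := (Real.continuous_sqrt.tendsto 0).comp h5
  simpa [Function.comp_def, Real.sqrt_sq] using this

end FormSpace

/-! ### Resolvents of a closed nonnegative form. -/

/-- `T = α (L + α)⁻¹` for the operator `L` associated with `q`. -/
def IsResolvent (q : QForm E) (α : ℝ) (T : E →ₗ[ℝ] q.domain) : Prop :=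
  ∀ (f : E) (h : q.domain), q.form (T f) h = α * inner ℝ (f - (T f : E)) (h : E)

/-- With `J` the embedding of the form space into `E`, the adjoint satisfies `q(J* f, h) + α ⟪J* f,
h⟫ = ⟪f, h⟫`, so `J*` is `(L + α)⁻¹` and `T = α J*`. -/
theorem exists_isResolvent [CompleteSpace E] (q : QForm E) (hc : q.Closed) (hn : q.Nonneg)
    {α : ℝ} (hα : 0 < α) : ∃ T : E →ₗ[ℝ] q.domain, q.IsResolvent α T := by
  refine ⟨α • (FormSpace.toDomain q hc hn α hα).toLinearMap ∘ₗ
    (ContinuousLinearMap.adjoint (FormSpace.embedding q hc hn α hα)).toLinearMap, fun f h => ?_⟩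
  have h1 := ContinuousLinearMap.adjoint_inner_left (FormSpace.embedding q hc hn α hα)
    ((FormSpace.toDomain q hc hn α hα).symm h) f
  rw [FormSpace.inner_def, FormSpace.embedding_apply, LinearEquiv.apply_symm_apply] at h1
  simp only [LinearMap.smul_apply, LinearMap.comp_apply, LinearEquiv.coe_coe,
    ContinuousLinearMap.coe_coe, map_smul, smul_eq_mul, Submodule.coe_smul, inner_sub_left,
    real_inner_smul_left]
  linear_combination α * h1

namespace IsResolvent

variable {q : QForm E} {α : ℝ} {T : E →ₗ[ℝ] q.domain}

/-- Completing the square around `T f`: the cross terms cancel by the resolvent equation. It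
exhibits `T f` as the unique minimizer of `k ↦ q(k) + α ‖f - k‖²`, with the exact excess for any
other `k`. -/
theorem val_add_norm (hT : q.IsResolvent α T) (f : E) (k : q.domain) :
    q.val k + α * ‖f - (k : E)‖ ^ 2 = q.val (T f) + α * ‖f - (T f : E)‖ ^ 2
      + q.val (k - T f) + α * ‖(k : E) - (T f : E)‖ ^ 2 := by
  have h1 := hT f (k - T f)
  have h2 : f - (k : E) = (f - (T f : E)) - ((k : E) - (T f : E)) := by abel
  have h3 : q.val k = q.val (T f + (k - T f)) := by rw [add_sub_cancel]
  rw [h3, val_add, h1, h2, norm_sub_sq_real (f - (T f : E)), Submodule.coe_sub]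
  ring

theorem norm_apply_le (hT : q.IsResolvent α T) (hn : q.Nonneg) (hα : 0 < α) (f : E) :
    ‖(T f : E)‖ ≤ ‖f‖ := by
  have h1 := hn (T f)
  rw [val, hT, inner_sub_left, real_inner_self_eq_norm_sq] at h1
  have h2 := real_inner_le_norm f (T f : E)
  have h3 : ‖(T f : E)‖ ^ 2 ≤ ‖f‖ * ‖(T f : E)‖ := by
    have := (mul_nonneg_iff_of_pos_left hα).1 h1
    linarith
  by_contra! h4
  nlinarith [norm_nonneg f]

theorem inner_symm (hT : q.IsResolvent α T) (hα : 0 < α) (f g : E) :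
    inner ℝ (T f : E) g = inner ℝ f (T g : E) := by
  have h1 := hT f (T g)
  rw [q.symm, hT g (T f)] at h1
  have h2 := mul_left_cancel₀ hα.ne' h1
  rw [inner_sub_left, inner_sub_left, real_inner_comm (T g : E) (T f : E),
    real_inner_comm (T f : E) g] at h2
  linarith [real_inner_comm (T f : E) (T g : E)]

theorem continuous_coe (hT : q.IsResolvent α T) (hn : q.Nonneg) (hα : 0 < α) :
    Continuous fun f => (T f : E) := by
  have := (LinearMap.mkContinuous (q.domain.subtype ∘ₗ T) 1
    (fun f => by simpa using hT.norm_apply_le hn hα f)).continuous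
  exact this

/-- The left side is the approximating form, equal to `q(T f, f)`; the gap to `q(f)` is `q(f - T f)
+ α ‖f - T f‖²`. -/
theorem mul_inner_le_val (hT : q.IsResolvent α T) (hn : q.Nonneg) (hα : 0 < α) (f : q.domain) :
    α * inner ℝ ((f : E) - (T f : E)) (f : E) ≤ q.val f := by
  have h1 := hT f f
  have h2 := hT.val_add_norm f f
  have h3 := hn (f - T f)
  have h4 := hT f (T f)
  have h5 := q.val_sub f (T f)
  rw [q.symm] at h5
  rw [sub_self, norm_zero] at h2
  have : 0 ≤ α * ‖(f : E) - (T f : E)‖ ^ 2 := by positivity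
  rw [← h1]
  nlinarith

end IsResolvent

/-- As `α → ∞`, the approximations `α (L + α)⁻¹ f` of `f ∈ D(q)` converge to `f` in form norm. -/
theorem tendsto_resolvent (q : QForm E) (hc : q.Closed) (hn : q.Nonneg)
    {T : ℕ → E →ₗ[ℝ] q.domain} (hT : ∀ n : ℕ, q.IsResolvent (n + 1) (T n)) (f : q.domain) :
    Filter.Tendsto (fun n => (T n f : E)) Filter.atTop (nhds (f : E)) ∧
    Filter.Tendsto (fun n => q.val (T n f - f)) Filter.atTop (nhds 0) := by
  have hp : ∀ n : ℕ, (0 : ℝ) < n + 1 := fun n => by positivity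
  have hmin : ∀ n, q.val (T n f) + (n + 1) * ‖(f : E) - (T n f : E)‖ ^ 2 ≤ q.val f := by
    intro n
    have h1 := (hT n).val_add_norm f f
    have h2 := hn (f - T n f)
    have h3 : 0 ≤ ((n : ℝ) + 1) * ‖(f : E) - (T n f : E)‖ ^ 2 := by positivity
    rw [sub_self, norm_zero] at h1
    nlinarith
  have hlim : Filter.Tendsto (fun n => (T n f : E)) Filter.atTop (nhds (f : E)) := by
    rw [tendsto_iff_norm_sub_tendsto_zero]
    have h1 : Filter.Tendsto (fun n => ‖(T n f : E) - f‖ ^ 2) Filter.atTop (nhds 0) := by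
      have h2 : Filter.Tendsto (fun n : ℕ => q.val f * (1 / ((n : ℝ) + 1))) Filter.atTop
          (nhds 0) := by
        simpa using tendsto_one_div_add_atTop_nhds_zero_nat.const_mul (q.val f)
      refine squeeze_zero (fun _ => sq_nonneg _) (fun n => ?_) h2
      rw [mul_one_div, le_div_iff₀ (hp n), norm_sub_rev]
      linarith [hmin n, hn (T n f)]
    have := (Real.continuous_sqrt.tendsto 0).comp h1
    simpa [Function.comp_def, Real.sqrt_sq] using this
  refine ⟨hlim, ?_⟩
  -- The energies of `T n f` increase with `n`, and the increments control the distances in `q`.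
  -- Being bounded by `q(f)`, the energies converge, so `T n f` is Cauchy in form norm.
  have hstep : ∀ m n : ℕ, m ≤ n → q.val (T n f - T m f) ≤ q.val (T n f) - q.val (T m f) := by
    intro m n hmn
    have h1 := (hT m).val_add_norm f (T n f)
    have h2 := (hT n).val_add_norm f (T m f)
    have h3 := hn (T n f - T m f)
    have h4 := hn (T m f - T n f)
    have h5 : 0 ≤ ((m : ℝ) + 1) * ‖(T n f : E) - (T m f : E)‖ ^ 2 := by positivity
    have h6 : 0 ≤ ((n : ℝ) + 1) * ‖(T m f : E) - (T n f : E)‖ ^ 2 := by positivity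
    have h7 : (m : ℝ) ≤ n := by exact_mod_cast hmn
    rcases hmn.eq_or_lt with rfl | hlt
    · simp [val]
    have h8 : (m : ℝ) < n := by exact_mod_cast hlt
    -- Adding the two minimality relations cancels the energies and leaves `(n - m)(‖f - T n f‖² -
    -- ‖f - T m f‖²) ≤ 0`.
    have h9 : ‖(f : E) - (T n f : E)‖ ^ 2 ≤ ‖(f : E) - (T m f : E)‖ ^ 2 := by
      by_contra! h
      nlinarith
    nlinarith [hp m]
  have hmono : Monotone fun n => q.val (T n f) := fun m n hmn => by
    have := hstep m n hmn
    have := hn (T n f - T m f)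
    simp only
    linarith
  have hbdd : BddAbove (Set.range fun n => q.val (T n f)) := by
    refine ⟨q.val f, ?_⟩
    rintro _ ⟨n, rfl⟩
    have h3 : 0 ≤ ((n : ℝ) + 1) * ‖(f : E) - (T n f : E)‖ ^ 2 := by positivity
    simp only
    linarith [hmin n]
  have hcau := (tendsto_atTop_ciSup hmono hbdd).cauchySeq
  have h1 : Filter.Tendsto (fun mn : ℕ × ℕ => q.val (T mn.1 f - T mn.2 f)) Filter.atTop
      (nhds 0) := by
    refine squeeze_zero (fun _ => hn _) (fun mn => ?_) (cauchySeq_iff_tendsto_dist_atTop_0.1 hcau)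
    rw [Real.dist_eq]
    rcases le_total mn.1 mn.2 with h | h
    · have h2 : q.val (T mn.1 f - T mn.2 f) = q.val (T mn.2 f - T mn.1 f) := by
        rw [val_sub, val_sub, q.symm]
        ring
      rw [h2, abs_sub_comm]
      exact (hstep _ _ h).trans (le_abs_self _)
    · exact (hstep _ _ h).trans (le_abs_self _)
  obtain ⟨_, h2⟩ := hc.complete (fun n => T n f) f hlim h1
  exact h2

theorem tendsto_form_of_tendsto_val (q : QForm E) (hn : q.Nonneg) {ι : Type*} {l : Filter ι}
    {u : ι → q.domain} {f : q.domain}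
    (hu : Filter.Tendsto (fun n => q.val (u n - f)) l (nhds 0)) (h : q.domain) :
    Filter.Tendsto (fun n => q.form (u n) h) l (nhds (q.form f h)) := by
  rw [tendsto_iff_norm_sub_tendsto_zero]
  have h1 : Filter.Tendsto (fun n => Real.sqrt (q.val (u n - f) * q.val h)) l (nhds 0) := by
    have := (Real.continuous_sqrt.tendsto 0).comp
      (show Filter.Tendsto (fun n => q.val (u n - f) * q.val h) l (nhds 0) by
        simpa using hu.mul_const (q.val h))
    simpa [Function.comp_def] using this
  refine squeeze_zero (fun _ => norm_nonneg _) (fun n => ?_) h1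
  have h2 : q.form (u n) h - q.form f h = q.form (u n - f) h := by
    rw [map_sub, LinearMap.sub_apply]
  rw [h2, Real.norm_eq_abs]
  exact Real.abs_le_sqrt (q.form_sq_le hn _ _)

/-! ### Semi-bounded forms, and uniqueness of the form domain of an operator. -/

/-- The form obtained from a lower semi-bounded form by adding a multiple of the inner product. -/
def shift (q : QForm E) (c : ℝ) : QForm E where
  domain := q.domain
  form := q.form + c • (innerₗ E).compl₁₂ q.domain.subtype q.domain.subtype
  symm f g := by
    simp only [LinearMap.add_apply, LinearMap.smul_apply, LinearMap.compl₁₂_apply,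
      Submodule.subtype_apply, innerₗ_apply_apply]
    rw [q.symm, real_inner_comm]

theorem shift_val (q : QForm E) (c : ℝ) (f : q.domain) :
    (q.shift c).val f = q.val f + c * ‖(f : E)‖ ^ 2 := by
  rw [← real_inner_self_eq_norm_sq]
  rfl

theorem tendsto_val_of_nonneg (q : QForm E) (hn : q.Nonneg) {ι : Type*} {l : Filter ι}
    {u : ι → q.domain} {f : q.domain}
    (hu : Filter.Tendsto (fun n => q.val (u n - f)) l (nhds 0)) :
    Filter.Tendsto (fun n => q.val (u n)) l (nhds (q.val f)) := by
  have h1 := (hu.add ((q.tendsto_form_of_tendsto_val hn hu f).const_mul 2)).sub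
    (tendsto_const_nhds (x := q.val f))
  have h2 : 0 + 2 * q.form f f - q.val f = q.val f := by
    rw [show q.val f = q.form f f from rfl]
    ring
  rw [h2] at h1
  refine h1.congr fun n => ?_
  rw [q.val_sub (u n) f]
  ring

/-- Shifting makes the form nonnegative, at the cost of also requiring convergence in `E`.
Semi-bounded forms enter as competitors in the minimality of the closure. -/
theorem tendsto_val_of_tendsto_val_sub (q : QForm E) (hq : q.LowerSemibounded) {ι : Type*}
    {l : Filter ι} {u : ι → q.domain} {f : q.domain}
    (hE : Filter.Tendsto (fun n => (u n : E)) l (nhds (f : E)))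
    (hu : Filter.Tendsto (fun n => q.val (u n - f)) l (nhds 0)) :
    Filter.Tendsto (fun n => q.val (u n)) l (nhds (q.val f)) := by
  obtain ⟨C, hC⟩ := hq
  have hn : (q.shift (-C)).Nonneg := fun f => by
    have h := hC f
    refine le_of_le_of_eq ?_ (shift_val q (-C) f).symm
    linarith
  have h0 : Filter.Tendsto (fun n => ‖(u n : E) - f‖ ^ 2) l (nhds 0) := by
    simpa using (tendsto_iff_norm_sub_tendsto_zero.1 hE).pow 2
  have h1 := hu.add (h0.const_mul (-C))
  rw [mul_zero, add_zero] at h1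
  have h2 := (q.shift (-C)).tendsto_val_of_nonneg hn (u := u) (f := f)
    (h1.congr fun n => (shift_val q (-C) (u n - f)).symm)
  have h3 : Filter.Tendsto (fun n => q.val (u n) + -C * ‖(u n : E)‖ ^ 2) l
      (nhds (q.val f + -C * ‖(f : E)‖ ^ 2)) :=
    (h2.congr fun n => shift_val q (-C) (u n)).trans (congrArg nhds (shift_val q (-C) f)).le
  simpa using h3.sub ((hE.norm.pow 2).const_mul (-C))

theorem Closed.shift {q : QForm E} (hq : q.Closed) (c : ℝ) : (q.shift c).Closed where
  dense := hq.dense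
  lowerSemibounded := by
    obtain ⟨C, hC⟩ := hq.lowerSemibounded
    refine ⟨C + c, fun f => ?_⟩
    have h := hC f
    refine le_of_le_of_eq ?_ (shift_val q c f).symm
    linarith
  complete := by
    intro (u : ℕ → q.domain) f hu hu'
    have h1 : Filter.Tendsto (fun mn : ℕ × ℕ => ‖(u mn.1 : E) - (u mn.2 : E)‖ ^ 2)
        Filter.atTop (nhds 0) := by
      have := (cauchySeq_iff_tendsto_dist_atTop_0.1 hu.cauchySeq).pow 2
      simpa [dist_eq_norm] using this
    have h2 := hu'.sub (h1.const_mul c)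
    rw [mul_zero, sub_zero] at h2
    have h3 : ∀ v : q.domain, (q.shift c).val v - c * ‖(v : E)‖ ^ 2 = q.val v := fun v =>
      sub_eq_of_eq_add (shift_val q c v)
    obtain ⟨hf, h4⟩ := hq.complete u f hu (h2.congr fun mn => h3 (u mn.1 - u mn.2))
    have h5 : Filter.Tendsto (fun n => ‖(u n : E) - f‖ ^ 2) Filter.atTop (nhds 0) := by
      simpa using (tendsto_iff_norm_sub_tendsto_zero.1 hu).pow 2
    have h6 := h4.add (h5.const_mul c)
    rw [mul_zero, add_zero] at h6
    exact ⟨hf, h6.congr fun n => (shift_val q c (u n - ⟨f, hf⟩)).symm⟩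

/-- Both values are `⟪L f, f⟫`. -/
theorem IsFormOf.val_eq {q p : QForm E} {L : E →ₗ.[ℝ] E} (hq : q.IsFormOf L) (hp : p.IsFormOf L)
    {f : E} (hf : f ∈ L.domain) : ∃ (h₁ : f ∈ q.domain) (h₂ : f ∈ p.domain),
      q.val ⟨f, h₁⟩ = p.val ⟨f, h₂⟩ := by
  have hg := L.mem_graph ⟨f, hf⟩
  obtain ⟨h₁, e₁⟩ := (hq.mem_graph_iff _ _).1 hg
  obtain ⟨h₂, e₂⟩ := (hp.mem_graph_iff _ _).1 hg
  exact ⟨h₁, h₂, (e₁ ⟨f, h₁⟩).trans (e₂ ⟨f, h₂⟩).symm⟩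

/-- Two closed forms of the same operator have the same domain. -/
theorem IsFormOf.domain_le [CompleteSpace E] {q p : QForm E} {L : E →ₗ.[ℝ] E}
    (hq : q.IsFormOf L) (hp : p.IsFormOf L) : q.domain ≤ p.domain := by
  intro f hf
  obtain ⟨C, hC⟩ := hq.closed.lowerSemibounded
  have hn : (q.shift (-C)).Nonneg := fun f => by
    have h := hC f
    refine le_of_le_of_eq ?_ (shift_val q (-C) f).symm
    linarith
  have hc := hq.closed.shift (-C)
  choose T hT using fun n : ℕ =>
    (q.shift (-C)).exists_isResolvent hc hn (α := (n : ℝ) + 1) (by positivity)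
  obtain ⟨h1, h2⟩ := (q.shift (-C)).tendsto_resolvent hc hn hT ⟨f, hf⟩
  -- The resolvents belong to `L - C`, so `L (T n f)` is `(n + 1)(f - T n f)` plus `C • T n f`. Thus
  -- `f` is approximated from `D(L)`, where `q` and `p` coincide.
  have hL : ∀ n, (T n f : E) ∈ L.domain := fun n => by
    refine LinearPMap.mem_domain_of_mem_graph
      (y := ((n : ℝ) + 1) • (f - (T n f : E)) + C • (T n f : E))
      ((hq.mem_graph_iff _ _).2 ⟨(T n f).2, fun h => ?_⟩)
    have h3 : q.form (T n f) h + -C * inner ℝ (T n f : E) (h : E)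
        = (n + 1) * inner ℝ (f - (T n f : E)) (h : E) := hT n f h
    have h4 : q.form (T n f) h = inner ℝ (((n : ℝ) + 1) • (f - (T n f : E)) + C • (T n f : E))
        (h : E) := by
      rw [inner_add_left, real_inner_smul_left, real_inner_smul_left]
      linarith
    exact h4
  have hdiff : Filter.Tendsto (fun mn : ℕ × ℕ => q.val (T mn.1 f - T mn.2 f)) Filter.atTop
      (nhds 0) := by
    have h3 : Filter.Tendsto (fun mn : ℕ × ℕ => (q.shift (-C)).val (T mn.1 f - T mn.2 f))
        Filter.atTop (nhds 0) := by
      rw [← Filter.prod_atTop_atTop_eq]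
      have h4 := ((h2.comp Filter.tendsto_fst).const_mul 2).add
        ((h2.comp (Filter.tendsto_snd (f := Filter.atTop (α := ℕ)))).const_mul 2)
      rw [mul_zero, add_zero] at h4
      refine squeeze_zero (fun _ => hn _) (fun mn => ?_) h4
      have e : T mn.1 f - T mn.2 f = (T mn.1 f - ⟨f, hf⟩) - (T mn.2 f - ⟨f, hf⟩) := by abel
      rw [e, val_sub]
      -- Nonnegativity at `a + b` gives `q(a - b) ≤ 2 q(a) + 2 q(b)`, which serves in place of a
      -- triangle inequality here and below.
      have h5 := hn ((T mn.1 f - ⟨f, hf⟩) + (T mn.2 f - ⟨f, hf⟩))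
      rw [val_add] at h5
      simp only [Function.comp_apply]
      linarith
    have h4 : Filter.Tendsto (fun mn : ℕ × ℕ => ‖(T mn.1 f : E) - (T mn.2 f : E)‖ ^ 2)
        Filter.atTop (nhds 0) := by
      have := (cauchySeq_iff_tendsto_dist_atTop_0.1 h1.cauchySeq).pow 2
      simpa [dist_eq_norm] using this
    have h5 := h3.sub (h4.const_mul (-C))
    rw [mul_zero, sub_zero] at h5
    exact h5.congr fun mn => sub_eq_of_eq_add (shift_val q (-C) (T mn.1 f - T mn.2 f))
  have hP : ∀ n, (T n f : E) ∈ p.domain := fun n => (hq.val_eq hp (hL n)).2.1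
  refine (hp.closed.complete (fun n => ⟨T n f, hP n⟩) f h1 (hdiff.congr fun mn => ?_)).1
  exact (hq.val_eq hp (L.domain.sub_mem (hL mn.1) (hL mn.2))).2.2

/-! ### Closure of a form that has a closed nonnegative extension. -/

/-- The closure of a subspace of the domain with respect to the form norm. -/
def formClosure (q : QForm E) (hn : q.Nonneg) (S : Submodule ℝ E) (hS : S ≤ q.domain) :
    Submodule ℝ E where
  carrier := {f | ∃ (hf : f ∈ q.domain) (u : ℕ → S),
    Filter.Tendsto (fun n => (u n : E)) Filter.atTop (nhds f) ∧
    Filter.Tendsto (fun n => q.val (⟨u n, hS (u n).2⟩ - ⟨f, hf⟩)) Filter.atTop (nhds 0)}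
  zero_mem' := ⟨q.domain.zero_mem, fun _ => 0, by simp, by
    refine tendsto_const_nhds.congr fun n => ?_
    have : (⟨((0 : S) : E), hS (0 : S).2⟩ - ⟨0, q.domain.zero_mem⟩ : q.domain) = 0 := by
      ext
      simp
    rw [this]
    simp [val]⟩
  add_mem' := by
    rintro f g ⟨hf, u, hu, hu'⟩ ⟨hg, v, hv, hv'⟩
    refine ⟨q.domain.add_mem hf hg, fun n => u n + v n, hu.add hv, ?_⟩
    have h1 := (hu'.const_mul 2).add (hv'.const_mul 2)
    rw [mul_zero, add_zero] at h1
    refine squeeze_zero (fun _ => hn _) (fun n => ?_) h1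
    have e : (⟨((u n + v n : S) : E), hS (u n + v n).2⟩ - ⟨f + g, q.domain.add_mem hf hg⟩ : q.domain)
        = (⟨u n, hS (u n).2⟩ - ⟨f, hf⟩) + (⟨v n, hS (v n).2⟩ - ⟨g, hg⟩) := by
      ext
      simp only [Submodule.coe_sub, Submodule.coe_add]
      abel
    rw [e, val_add]
    have := hn ((⟨u n, hS (u n).2⟩ - ⟨f, hf⟩) - (⟨v n, hS (v n).2⟩ - ⟨g, hg⟩))
    rw [val_sub] at this
    linarith
  smul_mem' := by
    rintro c f ⟨hf, u, hu, hu'⟩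
    refine ⟨q.domain.smul_mem c hf, fun n => c • u n, hu.const_smul c, ?_⟩
    have h1 := hu'.const_mul (c ^ 2)
    rw [mul_zero] at h1
    refine h1.congr fun n => ?_
    rw [← val_smul]
    congr 1
    ext
    simp [smul_sub]

theorem formClosure_le (q : QForm E) (hn : q.Nonneg) (S : Submodule ℝ E) (hS : S ≤ q.domain) :
    q.formClosure hn S hS ≤ q.domain := fun _ hf => hf.1

theorem le_formClosure (q : QForm E) (hn : q.Nonneg) (S : Submodule ℝ E) (hS : S ≤ q.domain) :
    S ≤ q.formClosure hn S hS := fun f hf =>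
  ⟨hS hf, fun _ => ⟨f, hf⟩, tendsto_const_nhds, by simp [val]⟩

theorem closed_restrict_formClosure (q : QForm E) (hc : q.Closed) (hn : q.Nonneg)
    (S : Submodule ℝ E) (hS : S ≤ q.domain) (hd : Dense (S : Set E)) :
    (q.restrict (q.formClosure hn S hS) (q.formClosure_le hn S hS)).Closed where
  dense := hd.mono (q.le_formClosure hn S hS)
  lowerSemibounded := ⟨0, fun f => by
    rw [zero_mul]
    exact hn ⟨f, q.formClosure_le hn S hS f.2⟩⟩
  complete := by
    intro u f hu hu'
    obtain ⟨hf, h1⟩ := hc.complete (fun n => ⟨u n, q.formClosure_le hn S hS (u n).2⟩) f hu hu'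
    refine ⟨?_, h1⟩
    -- Diagonal argument: each `u n` is replaced by an element of `S` within `1 / (n + 1)` both in
    -- norm and in `q`.
    have h2 : ∀ n : ℕ, ∃ s : S, ‖(s : E) - (u n : E)‖ ≤ 1 / ((n : ℝ) + 1) ∧
        q.val (⟨s, hS s.2⟩ - ⟨u n, q.formClosure_le hn S hS (u n).2⟩) ≤ 1 / ((n : ℝ) + 1) := by
      intro n
      obtain ⟨hun, v, hv, hv'⟩ := (u n).2
      have hp : (0 : ℝ) < 1 / ((n : ℝ) + 1) := by positivity
      obtain ⟨k, hk, hk'⟩ := (((tendsto_iff_norm_sub_tendsto_zero.1 hv).eventually_le_const hp).and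
        (hv'.eventually_le_const hp)).exists
      exact ⟨v k, hk, hk'⟩
    choose s hs hs' using h2
    have hlim := tendsto_one_div_add_atTop_nhds_zero_nat (𝕜 := ℝ)
    refine ⟨hf, s, ?_, ?_⟩
    · have h3 : Filter.Tendsto (fun n => (s n : E) - (u n : E)) Filter.atTop (nhds 0) :=
        squeeze_zero_norm hs hlim
      simpa using h3.add hu
    · have h3 := (hlim.const_mul 2).add (h1.const_mul 2)
      rw [mul_zero, add_zero] at h3
      refine squeeze_zero (fun _ => hn _) (fun n => ?_) h3
      have e : (⟨s n, hS (s n).2⟩ - ⟨f, hf⟩ : q.domain)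
          = (⟨s n, hS (s n).2⟩ - ⟨u n, q.formClosure_le hn S hS (u n).2⟩)
            + (⟨u n, q.formClosure_le hn S hS (u n).2⟩ - ⟨f, hf⟩) := by abel
      rw [e, val_add]
      have h4 := hn ((⟨s n, hS (s n).2⟩ - ⟨u n, q.formClosure_le hn S hS (u n).2⟩)
            - (⟨u n, q.formClosure_le hn S hS (u n).2⟩ - ⟨f, hf⟩))
      rw [val_sub] at h4
      linarith [hs' n]

/-- A densely defined form with a closed nonnegative extension `q` has a closure, which is a
restriction of `q`. -/
theorem exists_isClosureOf (q p : QForm E) (hc : q.Closed) (hn : q.Nonneg)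
    (hd : Dense (p.domain : Set E)) (hqp : q.Extends p) :
    ∃ q₀ : QForm E, q₀.IsClosureOf p ∧ q.Extends q₀ := by
  have hS := hqp.1
  refine ⟨q.restrict (q.formClosure hn p.domain hS) (q.formClosure_le hn p.domain hS),
    ⟨q.closed_restrict_formClosure hc hn p.domain hS hd,
      ⟨q.le_formClosure hn p.domain hS, hqp.2⟩, fun r hr hrp => ?_⟩,
    ⟨q.formClosure_le hn p.domain hS, fun _ => rfl⟩⟩
  -- A competing closed extension `r` agrees with `q` on the approximating sequence, which is
  -- therefore Cauchy for `r` too. Completeness of `r` puts the limit in its domain, and both values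
  -- are limits of the same numbers.
  have key : ∀ f : q.formClosure hn p.domain hS, ∃ hf : (f : E) ∈ r.domain,
      r.val ⟨f, hf⟩ = q.val ⟨f, q.formClosure_le hn p.domain hS f.2⟩ := by
    rintro ⟨f, hf, u, hu, hu'⟩
    have h1 : Filter.Tendsto (fun mn : ℕ × ℕ => q.val
        ((⟨u mn.1, hS (u mn.1).2⟩ : q.domain) - ⟨u mn.2, hS (u mn.2).2⟩))
        Filter.atTop (nhds 0) := by
      rw [← Filter.prod_atTop_atTop_eq]
      have h3 := ((hu'.comp Filter.tendsto_fst).const_mul 2).add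
        ((hu'.comp (Filter.tendsto_snd (f := Filter.atTop (α := ℕ)))).const_mul 2)
      rw [mul_zero, add_zero] at h3
      refine squeeze_zero (fun _ => hn _) (fun mn => ?_) h3
      have e : ((⟨u mn.1, hS (u mn.1).2⟩ : q.domain) - ⟨u mn.2, hS (u mn.2).2⟩)
        = (⟨u mn.1, hS (u mn.1).2⟩ - ⟨f, hf⟩) - (⟨u mn.2, hS (u mn.2).2⟩ - ⟨f, hf⟩) := by abel
      rw [e, val_sub]
      have h4 := hn ((⟨u mn.1, hS (u mn.1).2⟩ - ⟨f, hf⟩) + (⟨u mn.2, hS (u mn.2).2⟩ - ⟨f, hf⟩))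
      rw [val_add] at h4
      simp only [Function.comp_apply]
      linarith
    have h2 : ∀ m n : ℕ, r.val ((⟨u m, hrp.1 (u m).2⟩ : r.domain) - ⟨u n, hrp.1 (u n).2⟩)
        = q.val ((⟨u m, hS (u m).2⟩ : q.domain) - ⟨u n, hS (u n).2⟩) := fun m n =>
      (hrp.2 (u m - u n)).trans (hqp.2 (u m - u n)).symm
    obtain ⟨hfr, h3⟩ := hr.complete (fun n => ⟨u n, hrp.1 (u n).2⟩) f hu
      (h1.congr fun mn => (h2 mn.1 mn.2).symm)
    refine ⟨hfr, tendsto_nhds_unique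
      (r.tendsto_val_of_tendsto_val_sub hr.lowerSemibounded hu h3) ?_⟩
    refine (q.tendsto_val_of_tendsto_val_sub hc.lowerSemibounded hu hu').congr fun n => ?_
    exact (hqp.2 (u n)).trans (hrp.2 (u n)).symm
  exact ⟨fun f hf => (key ⟨f, hf⟩).1, fun f => (key f).2⟩

end QForm

end DiscSchr
end

noncomputable section
namespace DiscSchr

open Filter Topology

variable {X : Type*}

/-! ### Point masses and finite truncations in `ℓ²(X, μ)`. -/

namespace EllTwo

variable {μ : Weight X}

theorem sub_apply (f g : EllTwo μ) (x : X) : (f - g) x = f x - g x := rfl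

open Classical in
/-- The indicator function of the point `x`. -/
def delta (μ : Weight X) (x : X) : EllTwo μ :=
  mk (Pi.single x 1) (summable_of_ne_finset_zero (s := {x}) fun y hy => by
    rw [Pi.single_eq_of_ne (by simpa using hy)]
    simp)

open Classical in
theorem delta_apply (x y : X) : delta μ x y = if y = x then 1 else 0 := by
  rw [delta, mk_apply, Pi.single_apply]

theorem delta_self (x : X) : delta μ x x = 1 := by simp [delta_apply]

theorem delta_of_ne {x y : X} (h : y ≠ x) : delta μ x y = 0 := by simp [delta_apply, h]

theorem delta_mem_finSupp (x : X) : delta μ x ∈ finSupp μ :=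
  (Set.finite_singleton x).subset fun y hy => by
    by_contra h
    exact hy (delta_of_ne h)

theorem delta_mem_Icc (x y : X) : delta μ x y ∈ Set.Icc (0 : ℝ) 1 := by
  rw [delta_apply]
  split_ifs <;> simp

theorem inner_delta (f : EllTwo μ) (x : X) : inner ℝ f (delta μ x) = f x * μ x := by
  rw [inner_def, tsum_eq_single x]
  · rw [delta_self, mul_one]
  · intro y hy
    rw [delta_of_ne hy]
    ring

/-- The truncation of `a` to the finite set `K`. -/
def trunc (μ : Weight X) (K : Finset X) (a : X → ℝ) : EllTwo μ := ∑ x ∈ K, a x • delta μ x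

open Classical in
theorem trunc_apply (K : Finset X) (a : X → ℝ) (y : X) :
    trunc μ K a y = if y ∈ K then a y else 0 := by
  have h : trunc μ K a y = ∑ x ∈ K, (a x • delta μ x) y := by
    change toFunₗ μ (∑ x ∈ K, a x • delta μ x) y = _
    rw [map_sum, Finset.sum_apply]
  rw [h]
  simp [smul_apply, delta_apply]

theorem trunc_one_mem_Icc (K : Finset X) (x : X) : trunc μ K 1 x ∈ Set.Icc (0 : ℝ) 1 := by
  classical
  rw [trunc_apply]
  split_ifs <;> simp

theorem trunc_mem_finSupp (K : Finset X) (a : X → ℝ) : trunc μ K a ∈ finSupp μ :=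
  Submodule.sum_mem _ fun x _ => Submodule.smul_mem _ _ (delta_mem_finSupp x)

theorem eq_trunc_of_mem_finSupp {f : EllTwo μ} (hf : f ∈ finSupp μ) :
    f = trunc μ (Set.Finite.toFinset hf) f := by
  refine ext fun x => ?_
  classical
  rw [trunc_apply]
  split_ifs with h
  · rfl
  · by_contra h'
    exact h ((Set.Finite.mem_toFinset hf).2 h')

theorem inner_trunc (f : EllTwo μ) (K : Finset X) (a : X → ℝ) :
    inner ℝ f (trunc μ K a) = ∑ x ∈ K, a x * f x * μ x := by
  rw [trunc, inner_sum]
  refine Finset.sum_congr rfl fun x _ => ?_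
  rw [real_inner_smul_right, inner_delta, mul_assoc]

theorem tendsto_trunc (f : EllTwo μ) :
    Tendsto (fun K => trunc μ K f) atTop (𝓝 f) := by
  rw [tendsto_iff_norm_sub_tendsto_zero]
  have h1 : ∀ K : Finset X, ‖trunc μ K f - f‖ ^ 2 = ‖f‖ ^ 2 - ∑ x ∈ K, f x ^ 2 * μ x := by
    intro K
    have h2 : ‖trunc μ K f‖ ^ 2 = ∑ x ∈ K, f x ^ 2 * μ x := by
      rw [← real_inner_self_eq_norm_sq, inner_trunc]
      refine Finset.sum_congr rfl fun x hx => ?_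
      classical
      rw [trunc_apply, if_pos hx]
      ring
    have h3 : inner ℝ f (trunc μ K f) = ∑ x ∈ K, f x ^ 2 * μ x := by
      rw [inner_trunc]
      exact Finset.sum_congr rfl fun x hx => by ring
    rw [norm_sub_sq_real, h2, real_inner_comm, h3]
    ring
  have h4 : Tendsto (fun K => ‖trunc μ K f - f‖ ^ 2) atTop (𝓝 0) := by
    simp_rw [h1]
    rw [norm_sq_eq]
    have h5 := (tendsto_const_nhds (x := ∑' x, f x ^ 2 * μ x)).sub f.summable_sq.hasSum
    rwa [sub_self] at h5
  simpa [Function.comp_def, Real.sqrt_sq] using (Real.continuous_sqrt.tendsto 0).comp h4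

theorem dense_finSupp : Dense (finSupp μ : Set (EllTwo μ)) := fun f =>
  mem_closure_of_tendsto (tendsto_trunc f) (Eventually.of_forall fun K => trunc_mem_finSupp K f)

theorem tendsto_apply {ι : Type*} {l : Filter ι} {u : ι → EllTwo μ} {f : EllTwo μ}
    (h : Tendsto u l (𝓝 f)) (x : X) : Tendsto (fun n => u n x) l (𝓝 (f x)) := by
  have h1 := (h.inner (tendsto_const_nhds (x := delta μ x)) (𝕜 := ℝ)).div_const (μ x)
  simpa only [inner_delta, mul_div_cancel_right₀ _ (μ.pos x).ne'] using h1

end EllTwo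

open EllTwo

/-! ### The Markov property of resolvents, and Green's formula. -/

/-- Truncation of the values to `[0, 1]`. -/
theorem normalContraction_clamp : NormalContraction fun s => max 0 (min s 1) where
  map_zero := by simp
  contr s t := by
    refine (abs_max_sub_max_le_abs (min s 1) (min t 1) 0 |>.trans ?_ |> (by simpa [max_comm] using ·))
    simpa using abs_min_sub_min_le_max s 1 t 1

theorem clamp_of_mem {s : ℝ} (hs : s ∈ Set.Icc (0 : ℝ) 1) : max 0 (min s 1) = s := by
  rw [min_eq_left hs.2, max_eq_right hs.1]

variable {μ : Weight X}

/-- Resolvents of Dirichlet forms are Markovian. -/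
theorem IsDirichletForm.resolvent_mem_Icc {q : QForm (EllTwo μ)} (hq : IsDirichletForm q)
    {α : ℝ} (hα : 0 < α) {T : EllTwo μ →ₗ[ℝ] q.domain} (hT : q.IsResolvent α T)
    {f : EllTwo μ} (hf : ∀ x, f x ∈ Set.Icc (0 : ℝ) 1) (x : X) :
    (T f : EllTwo μ) x ∈ Set.Icc (0 : ℝ) 1 := by
  obtain ⟨hk, hle⟩ := hq.contraction _ normalContraction_clamp (T f)
  set k := normalContraction_clamp.comp (T f : EllTwo μ) with hkdef
  have hkx : ∀ y, k y = max 0 (min ((T f : EllTwo μ) y) 1) := fun y => rfl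
  -- The clamped function `k` has no more energy than `T f` and is no farther from `f`, because
  -- clamping fixes the values of `f`. Uniqueness of the minimizer forces `k = T f`.
  have h1 := hT.val_add_norm f ⟨k, hk⟩
  have h2 : ‖f - k‖ ^ 2 ≤ ‖f - (T f : EllTwo μ)‖ ^ 2 := by
    rw [norm_sq_eq, norm_sq_eq]
    refine Summable.tsum_le_tsum (fun y => ?_) (summable_sq _) (summable_sq _)
    refine mul_le_mul_of_nonneg_right (sq_le_sq.2 ?_) (μ.pos y).le
    rw [EllTwo.sub_apply, EllTwo.sub_apply, hkx]
    have := normalContraction_clamp.contr (f y) ((T f : EllTwo μ) y)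
    rwa [clamp_of_mem (hf y)] at this
  have h3 := hq.nonneg (⟨k, hk⟩ - T f)
  have h4 := mul_le_mul_of_nonneg_left h2 hα.le
  have h5 : α * ‖k - (T f : EllTwo μ)‖ ^ 2 ≤ 0 := by
    simp only at h1
    linarith
  have h6 : ‖k - (T f : EllTwo μ)‖ = 0 := by
    have h7 : ‖k - (T f : EllTwo μ)‖ ^ 2 ≤ 0 := by
      by_contra! h
      nlinarith
    nlinarith [norm_nonneg (k - (T f : EllTwo μ))]
  have h8 : k = T f := sub_eq_zero.1 (norm_eq_zero.1 h6)
  rw [← h8, hkx]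
  exact ⟨le_max_left _ _, max_le zero_le_one (min_le_right _ _)⟩

variable {G : WeightedGraph X} {V : X → ℝ}

theorem summable_weight_mul_sub (G : WeightedGraph X) {f : X → ℝ}
    (hf : ∀ y, f y ∈ Set.Icc (0 : ℝ) 1) (x : X) :
    Summable fun y => G.b x y * (f x - f y) := by
  refine Summable.of_norm_bounded (G.summable x) fun y => ?_
  rw [norm_mul, Real.norm_eq_abs, Real.norm_eq_abs, abs_of_nonneg (G.nonneg x y)]
  refine mul_le_of_le_one_right (G.nonneg x y) (abs_le.2 ?_)
  obtain ⟨h1, h2⟩ := hf x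
  obtain ⟨h3, h4⟩ := hf y
  constructor <;> linarith

/-- Values in `[0, 1]` make `b(x, ·)` a summable majorant, so pointwise convergence suffices even at
vertices of infinite degree. -/
theorem tendsto_formalOp (G : WeightedGraph X) (μ : Weight X) (V : X → ℝ) {ι : Type*}
    {l : Filter ι} {u : ι → X → ℝ} {f : X → ℝ} (hu : ∀ n y, u n y ∈ Set.Icc (0 : ℝ) 1)
    (h : ∀ y, Tendsto (fun n => u n y) l (𝓝 (f y))) (x : X) :
    Tendsto (fun n => formalOp G μ V (u n) x) l (𝓝 (formalOp G μ V f x)) := by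
  refine (Tendsto.const_mul _ ?_).add ((h x).const_mul _)
  refine tendsto_tsum_of_dominated_convergence (G.summable x)
    (fun y => ((h x).sub (h y)).const_mul _) (Eventually.of_forall fun n y => ?_)
  rw [norm_mul, Real.norm_eq_abs, Real.norm_eq_abs, abs_of_nonneg (G.nonneg x y)]
  refine mul_le_of_le_one_right (G.nonneg x y) (abs_le.2 ?_)
  obtain ⟨h1, h2⟩ := hu n x
  obtain ⟨h3, h4⟩ := hu n y
  constructor <;> linarith

/-- Green's formula for the Schrödinger form, tested against the indicator function of a point. -/
theorem neumannForm_delta (G : WeightedGraph X) (μ : Weight X) (V : X → ℝ)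
    (f : (neumannForm G μ V).domain) (hf : ∀ y, (f : EllTwo μ) y ∈ Set.Icc (0 : ℝ) 1) (x : X) :
    (neumannForm G μ V).form f ⟨delta μ x, finSupp_le_neumannForm G μ V (delta_mem_finSupp x)⟩
      = μ x * formalOp G μ V (f : EllTwo μ) x := by
  obtain ⟨g, hg⟩ := f
  have hrow := (summable_weight_mul_sub G hf x).hasSum
  have h1 : HasSum (fun p : X × X => G.b p.1 p.2 * (g p.1 - g p.2) * delta μ x p.1)
      (∑' y, G.b x y * (g x - g y)) := by
    have hinj : Function.Injective fun y : X => (x, y) := fun y z h => (Prod.mk.inj h).2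
    refine (hinj.hasSum_iff ?_).1 ?_
    · rintro ⟨a, c⟩ hac
      rw [delta_of_ne, mul_zero]
      rintro rfl
      exact hac ⟨c, rfl⟩
    · simpa [Function.comp_def, delta_self] using hrow
  -- Swapping the two vertices turns this sum into the negative of the previous one; their
  -- difference doubles the row sum and absorbs the factor `1 / 2`.
  have h2 : HasSum (fun p : X × X => G.b p.1 p.2 * (g p.1 - g p.2) * delta μ x p.2)
      (-∑' y, G.b x y * (g x - g y)) := by
    have e : (fun p : X × X => G.b p.1 p.2 * (g p.1 - g p.2) * delta μ x p.2)
        = fun p => -(G.b p.2 p.1 * (g p.2 - g p.1) * delta μ x p.2) := by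
      funext p
      rw [G.symm p.2 p.1]
      ring
    rw [e]
    exact ((Equiv.prodComm X X).hasSum_iff.2 h1).neg
  have h3 := (h1.sub h2).tsum_eq
  have h4 : ∑' y, V y * g y * delta μ x y * μ y = V x * g x * μ x := by
    rw [tsum_eq_single x]
    · rw [delta_self, mul_one]
    · intro y hy
      rw [delta_of_ne hy]
      ring
  have h5 : (neumannForm G μ V).form ⟨g, hg⟩
      ⟨delta μ x, finSupp_le_neumannForm G μ V (delta_mem_finSupp x)⟩
      = 1 / 2 * ∑' p : X × X, G.b p.1 p.2 * (g p.1 - g p.2) * (delta μ x p.1 - delta μ x p.2)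
        + ∑' y, V y * g y * delta μ x y * μ y := rfl
  rw [h5, h4, formalOp]
  simp_rw [mul_sub (G.b _ _ * (g _ - g _))]
  rw [h3]
  have := (μ.pos x).ne'
  field_simp
  ring

end DiscSchr
end

noncomputable section
namespace DiscSchr

open Filter Topology EllTwo

variable {X : Type*} {μ : Weight X} {G : WeightedGraph X} {V : X → ℝ}
  {H : EllTwo μ →ₗ.[ℝ] EllTwo μ} {Q : QForm (EllTwo μ)}

theorem mul_formalOp (G : WeightedGraph X) (μ : Weight X) (V : X → ℝ) (f : X → ℝ) (x : X) :
    μ x * formalOp G μ V f x = ∑' y, G.b x y * (f x - f y) + V x * f x * μ x := by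
  rw [formalOp, mul_add, mul_inv_cancel_left₀ (μ.pos x).ne']
  ring

/-! ### The form on `C_c(X)` and the sign of the potential. -/

namespace IsMarkovianRealization

/-- The form witnessing that `C_c(X)` lies in the form domain is not given as `Q` itself, so
`domain_le` is needed to transfer the inclusion. -/
theorem finSupp_le (hH : IsMarkovianRealization G μ V H Q) : finSupp μ ≤ Q.domain := by
  obtain ⟨q, hq, hle⟩ := hH.realization.finSupp_le
  exact hle.trans (hq.domain_le hH.isFormOf)

/-- The resolvent maps into `D(H)` with `H (T f) = α (f - T f)`. This is where the action of `H` as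
the formal operator enters. -/
theorem mul_sub_eq_formalOp (hH : IsMarkovianRealization G μ V H Q) {α : ℝ}
    {T : EllTwo μ →ₗ[ℝ] Q.domain} (hT : Q.IsResolvent α T) (f : EllTwo μ) (x : X) :
    α * (f x - (T f : EllTwo μ) x) = formalOp G μ V (T f : EllTwo μ) x := by
  have h1 : ((T f : EllTwo μ), α • (f - (T f : EllTwo μ))) ∈ H.graph :=
    (hH.isFormOf.mem_graph_iff _ _).2 ⟨(T f).2, fun h => by
      rw [real_inner_smul_left]
      exact hT f h⟩
  obtain ⟨y, hy, hy'⟩ := (LinearPMap.mem_graph_iff _).1 h1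
  have h2 := hH.realization.apply_eq y x
  simp only at hy hy'
  rw [hy, hy', smul_apply, EllTwo.sub_apply] at h2
  exact h2

theorem exists_resolvents (hH : IsMarkovianRealization G μ V H Q) :
    ∃ T : ℕ → EllTwo μ →ₗ[ℝ] Q.domain, ∀ n : ℕ, Q.IsResolvent (n + 1) (T n) := by
  choose T hT using fun n : ℕ => Q.exists_isResolvent hH.dirichlet.closed hH.dirichlet.nonneg
    (α := (n : ℝ) + 1) (by positivity)
  exact ⟨T, hT⟩

/-- For `T n f` in place of `f` this is the resolvent equation at `x`. The left side passes to the
limit by form convergence, the right side by `tendsto_formalOp`, since the Markov property keeps `T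
n f` in `[0, 1]`. -/
theorem form_delta (hH : IsMarkovianRealization G μ V H Q) (f : Q.domain)
    (hf : ∀ y, (f : EllTwo μ) y ∈ Set.Icc (0 : ℝ) 1) (x : X) :
    Q.form f ⟨delta μ x, hH.finSupp_le (delta_mem_finSupp x)⟩
      = μ x * formalOp G μ V (f : EllTwo μ) x := by
  obtain ⟨T, hT⟩ := hH.exists_resolvents
  obtain ⟨h1, h2⟩ := Q.tendsto_resolvent hH.dirichlet.closed hH.dirichlet.nonneg hT f
  have h3 := Q.tendsto_form_of_tendsto_val hH.dirichlet.nonneg h2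
    ⟨delta μ x, hH.finSupp_le (delta_mem_finSupp x)⟩
  have h4 := (tendsto_formalOp G μ V
    (fun n => hH.dirichlet.resolvent_mem_Icc (by positivity) (hT n) hf)
    (fun y => tendsto_apply h1 y) x).const_mul (μ x)
  refine tendsto_nhds_unique h3 (h4.congr fun n => ?_)
  rw [hT n, inner_delta, ← hH.mul_sub_eq_formalOp (hT n), EllTwo.sub_apply]
  ring

/-- The form of a Markovian realization agrees with the Schrödinger form on `C_c(X)`. -/
theorem extends_compactForm (hH : IsMarkovianRealization G μ V H Q) :
    Q.Extends (compactForm G μ V) := by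
  refine ⟨hH.finSupp_le, ?_⟩
  have hN := finSupp_le_neumannForm G μ V
  have expand : ∀ (q : QForm (EllTwo μ)) (hq : finSupp μ ≤ q.domain) (K : Finset X) (a : X → ℝ),
      q.val ⟨trunc μ K a, hq (trunc_mem_finSupp K a)⟩ = ∑ x ∈ K, ∑ y ∈ K, a x * (a y *
        q.form ⟨delta μ x, hq (delta_mem_finSupp x)⟩ ⟨delta μ y, hq (delta_mem_finSupp y)⟩) := by
    intro q hq K a
    have e : (⟨trunc μ K a, hq (trunc_mem_finSupp K a)⟩ : q.domain)
        = ∑ x ∈ K, a x • ⟨delta μ x, hq (delta_mem_finSupp x)⟩ := by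
      ext1
      simp [trunc]
    rw [e, QForm.val, LinearMap.map_sum₂]
    refine Finset.sum_congr rfl fun x _ => ?_
    simp only [map_sum, map_smul, LinearMap.smul_apply, smul_eq_mul]
    exact Finset.sum_congr rfl fun y _ => mul_left_comm _ _ _
  rintro ⟨f, hf⟩
  have h1 : Q.val ⟨f, hH.finSupp_le hf⟩ = (neumannForm G μ V).val ⟨f, hN hf⟩ := by
    obtain ⟨K, a, rfl⟩ : ∃ K a, f = trunc μ K a := ⟨_, _, eq_trunc_of_mem_finSupp hf⟩
    rw [expand Q hH.finSupp_le, expand _ hN]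
    refine Finset.sum_congr rfl fun x _ => Finset.sum_congr rfl fun y _ => ?_
    rw [hH.form_delta _ (delta_mem_Icc x),
      neumannForm_delta G μ V ⟨delta μ x, hN (delta_mem_finSupp x)⟩ (delta_mem_Icc x)]
  exact h1

/-- For `x ∈ K` and `t > 0`, clamping sends `1_K + t δ_x` to `1_K`. So the energy cannot drop in the
direction `δ_x`, and its right derivative at `t = 0` is nonnegative. -/
theorem form_trunc_one_delta_nonneg (hH : IsMarkovianRealization G μ V H Q) {K : Finset X} {x : X}
    (hx : x ∈ K) : 0 ≤ Q.form ⟨trunc μ K 1, hH.finSupp_le (trunc_mem_finSupp K 1)⟩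
      ⟨delta μ x, hH.finSupp_le (delta_mem_finSupp x)⟩ := by
  classical
  set u : Q.domain := ⟨trunc μ K 1, hH.finSupp_le (trunc_mem_finSupp K 1)⟩ with hu
  set d : Q.domain := ⟨delta μ x, hH.finSupp_le (delta_mem_finSupp x)⟩ with hd
  have h1 : ∀ t : ℝ, 0 < t → 0 ≤ 2 * Q.form u d + t * Q.val d := by
    intro t ht
    obtain ⟨h2, h3⟩ := hH.dirichlet.contraction _ normalContraction_clamp (u + t • d)
    have h4 : normalContraction_clamp.comp ((u + t • d : Q.domain) : EllTwo μ) = trunc μ K 1 := by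
      refine EllTwo.ext fun y => ?_
      have h5 : normalContraction_clamp.comp ((u + t • d : Q.domain) : EllTwo μ) y
          = max 0 (min (trunc μ K 1 y + t * delta μ x y) 1) := rfl
      rw [h5, trunc_apply, delta_apply]
      by_cases hyx : y = x
      · subst hyx
        simp [hx, ht.le]
      · by_cases hy : y ∈ K <;> simp [hyx, hy]
    have h6 : Q.val u ≤ Q.val (u + t • d) := by
      refine le_of_eq_of_le (congrArg Q.val (Subtype.ext h4.symm)) h3
    rw [Q.val_add, Q.val_smul, map_smul, smul_eq_mul] at h6
    have h7 : 0 ≤ t * (2 * Q.form u d + t * Q.val d) := by linarith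
    exact (mul_nonneg_iff_of_pos_left ht).1 h7
  by_contra! h
  have h8 := hH.dirichlet.nonneg d
  -- A step `t` small enough that the quadratic term cannot compensate the negative linear one; the
  -- `+ 1` covers `Q(d) = 0`.
  have h9 : 0 < -Q.form u d / (Q.val d + 1) := div_pos (neg_pos.2 h) (by linarith)
  have h10 := h1 _ h9
  have h11 : -Q.form u d / (Q.val d + 1) * Q.val d ≤ -Q.form u d := by
    rw [div_mul_eq_mul_div, div_le_iff₀ (by linarith)]
    nlinarith
  linarith

/-- As `K` exhausts `X`, `𝓗 1_K(x) → 𝓗 1(x) = V(x)`, and each `𝓗 1_K(x)` with `x ∈ K` is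
nonnegative. -/
theorem potential_nonneg (hH : IsMarkovianRealization G μ V H Q) (x : X) : 0 ≤ V x := by
  have h1 : Tendsto (fun K : Finset X => formalOp G μ V (trunc μ K 1) x) atTop
      (𝓝 (formalOp G μ V (fun _ => 1) x)) := by
    refine tendsto_formalOp G μ V (fun K y => trunc_one_mem_Icc K y) (fun y => ?_) x
    refine tendsto_const_nhds.congr' ?_
    filter_upwards [eventually_ge_atTop {y}] with K hK
    classical
    rw [trunc_apply, if_pos (hK (Finset.mem_singleton_self y)), Pi.one_apply]
  have h2 : formalOp G μ V (fun _ => 1) x = V x := by simp [formalOp]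
  rw [h2] at h1
  refine ge_of_tendsto h1 ?_
  filter_upwards [eventually_ge_atTop {x}] with K hK
  have h3 := hH.form_trunc_one_delta_nonneg (hK (Finset.mem_singleton_self x))
  rw [hH.form_delta _ (trunc_one_mem_Icc K)] at h3
  exact (mul_nonneg_iff_of_pos_left (μ.pos x)).1 h3

end IsMarkovianRealization

end DiscSchr
end

noncomputable section
namespace DiscSchr

open Filter Topology EllTwo

variable {X : Type*} {μ : Weight X} {G : WeightedGraph X} {V : X → ℝ}
  {H : EllTwo μ →ₗ.[ℝ] EllTwo μ} {Q : QForm (EllTwo μ)}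

/-! ### Comparison with the form `Q^(N)` through approximating forms. -/

/-- Rewriting of the quadratic form with coefficients `m x - t x y` as a graph form. -/
theorem sum_sub_sum_eq (K : Finset X) (m f : X → ℝ) (t : X → X → ℝ) (ht : ∀ x y, t x y = t y x) :
    ∑ x ∈ K, f x ^ 2 * m x - ∑ x ∈ K, ∑ y ∈ K, t x y * (f x * f y)
      = 1 / 2 * ∑ x ∈ K, ∑ y ∈ K, t x y * (f x - f y) ^ 2
        + ∑ x ∈ K, f x ^ 2 * (m x - ∑ y ∈ K, t x y) := by
  have h1 : ∑ x ∈ K, ∑ y ∈ K, t x y * f y ^ 2 = ∑ x ∈ K, ∑ y ∈ K, t x y * f x ^ 2 := by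
    rw [Finset.sum_comm]
    exact Finset.sum_congr rfl fun x _ => Finset.sum_congr rfl fun y _ => by rw [ht]
  have h2 : ∑ x ∈ K, ∑ y ∈ K, t x y * (f x - f y) ^ 2
      = ∑ x ∈ K, ∑ y ∈ K, t x y * f x ^ 2 + ∑ x ∈ K, ∑ y ∈ K, t x y * f y ^ 2
        - 2 * ∑ x ∈ K, ∑ y ∈ K, t x y * (f x * f y) := by
    simp only [Finset.mul_sum, ← Finset.sum_add_distrib, ← Finset.sum_sub_distrib]
    exact Finset.sum_congr rfl fun x _ => Finset.sum_congr rfl fun y _ => by ring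
  have h3 : ∑ x ∈ K, f x ^ 2 * (m x - ∑ y ∈ K, t x y)
      = ∑ x ∈ K, f x ^ 2 * m x - ∑ x ∈ K, ∑ y ∈ K, t x y * f x ^ 2 := by
    rw [← Finset.sum_sub_distrib]
    refine Finset.sum_congr rfl fun x _ => ?_
    rw [← Finset.sum_mul]
    ring
  rw [h2, h3, h1]
  ring

namespace IsMarkovianRealization

/-- The right side is the killing term of the approximating form on `K`. With `u = T 1_K`, the
resolvent equation rewrites it through `𝓗 u(x)`, and then `u ≤ 1` and `u(x) ≥ T δ_x(x)` remove `K`.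
The resulting bound tends to `V(x) μ(x)` as `α → ∞`. -/
theorem killing_le (hH : IsMarkovianRealization G μ V H Q) {α : ℝ} (hα : 0 < α)
    {T : EllTwo μ →ₗ[ℝ] Q.domain} (hT : Q.IsResolvent α T) {K : Finset X} {x : X} (hx : x ∈ K) :
    (∑' y, G.b x y) * ((T (delta μ x) : EllTwo μ) x - 1)
        + V x * (T (delta μ x) : EllTwo μ) x * μ x
      ≤ α * (μ x - (T (trunc μ K 1) : EllTwo μ) x * μ x) := by
  classical
  have hI := hH.dirichlet.resolvent_mem_Icc hα hT (trunc_one_mem_Icc (μ := μ) K)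
  have h1 : (T (delta μ x) : EllTwo μ) x ≤ (T (trunc μ K 1) : EllTwo μ) x := by
    have h2 : ∀ y, (trunc μ K 1 - delta μ x) y ∈ Set.Icc (0 : ℝ) 1 := by
      intro y
      rw [EllTwo.sub_apply, trunc_apply, delta_apply]
      by_cases hyx : y = x
      · subst hyx
        simp [hx]
      · by_cases hy : y ∈ K <;> simp [hyx, hy]
    have h3 := (hH.dirichlet.resolvent_mem_Icc hα hT h2 x).1
    rw [map_sub, Submodule.coe_sub, EllTwo.sub_apply] at h3
    linarith
  have h4 := hH.mul_sub_eq_formalOp hT (trunc μ K 1) x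
  rw [trunc_apply, if_pos hx, Pi.one_apply] at h4
  have h5 := mul_formalOp G μ V (T (trunc μ K 1) : EllTwo μ) x
  rw [← h4] at h5
  have h6 : α * (μ x - (T (trunc μ K 1) : EllTwo μ) x * μ x)
      = μ x * (α * (1 - (T (trunc μ K 1) : EllTwo μ) x)) := by ring
  rw [h6, h5, ← tsum_mul_right]
  refine add_le_add ?_ ?_
  · refine Summable.tsum_le_tsum (fun y => mul_le_mul_of_nonneg_left ?_ (G.nonneg x y))
      ((G.summable x).mul_right _) (summable_weight_mul_sub G hI x)
    linarith [(hI y).2]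
  · exact mul_le_mul_of_nonneg_right
      (mul_le_mul_of_nonneg_left h1 (hH.potential_nonneg x)) (μ.pos x).le

/-- On functions supported in `K` the approximating form is a graph form with weights `α ⟪T δ_x,
δ_y⟫ ≥ 0` and nonnegative killing, so contributions outside `L` may be dropped. The lower bound does
not involve `K`, which allows `K` to exhaust `X` while `α` is fixed. -/
theorem sum_le_mul_inner_trunc (hH : IsMarkovianRealization G μ V H Q) {α : ℝ} (hα : 0 < α)
    {T : EllTwo μ →ₗ[ℝ] Q.domain} (hT : Q.IsResolvent α T) {L K : Finset X} (hLK : L ⊆ K)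
    (f : X → ℝ) :
    1 / 2 * ∑ x ∈ L, ∑ y ∈ L,
        α * inner ℝ (T (delta μ x) : EllTwo μ) (delta μ y) * (f x - f y) ^ 2
      + ∑ x ∈ L, f x ^ 2 * ((∑' y, G.b x y) * ((T (delta μ x) : EllTwo μ) x - 1)
        + V x * (T (delta μ x) : EllTwo μ) x * μ x)
      ≤ α * inner ℝ (trunc μ K f - (T (trunc μ K f) : EllTwo μ)) (trunc μ K f) := by
  classical
  set t : X → X → ℝ := fun x y => inner ℝ (T (delta μ x) : EllTwo μ) (delta μ y) with ht
  have ht0 : ∀ x y, 0 ≤ t x y := fun x y => by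
    rw [ht]
    simp only [inner_delta]
    exact mul_nonneg (hH.dirichlet.resolvent_mem_Icc hα hT (delta_mem_Icc x) y).1 (μ.pos y).le
  have hts : ∀ x y, t x y = t y x := fun x y => by
    simp only [ht]
    rw [hT.inner_symm hα, real_inner_comm]
  have hrow : ∀ x, ∑ y ∈ K, t x y = (T (trunc μ K 1) : EllTwo μ) x * μ x := fun x => by
    rw [← inner_delta, hT.inner_symm hα, real_inner_comm, trunc, inner_sum]
    exact Finset.sum_congr rfl fun y _ => by rw [Pi.one_apply, one_smul]
  have h1 : inner ℝ (trunc μ K f - (T (trunc μ K f) : EllTwo μ)) (trunc μ K f)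
      = ∑ x ∈ K, f x ^ 2 * μ x - ∑ x ∈ K, ∑ y ∈ K, t x y * (f x * f y) := by
    rw [inner_sub_left]
    congr 1
    · rw [inner_trunc]
      refine Finset.sum_congr rfl fun x hx => ?_
      rw [trunc_apply, if_pos hx]
      ring
    · have e : (T (trunc μ K f) : EllTwo μ) = ∑ x ∈ K, f x • (T (delta μ x) : EllTwo μ) := by
        simp [trunc]
      rw [e, sum_inner]
      refine Finset.sum_congr rfl fun x _ => ?_
      rw [real_inner_smul_left, trunc, inner_sum, Finset.mul_sum]
      refine Finset.sum_congr rfl fun y _ => ?_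
      rw [real_inner_smul_right]
      ring
  rw [h1, sum_sub_sum_eq K _ f t hts, mul_add]
  refine add_le_add ?_ ?_
  · have h2 : ∑ x ∈ L, ∑ y ∈ L, t x y * (f x - f y) ^ 2
        ≤ ∑ x ∈ K, ∑ y ∈ K, t x y * (f x - f y) ^ 2 :=
      (Finset.sum_le_sum fun x _ => Finset.sum_le_sum_of_subset_of_nonneg hLK
        fun y _ _ => mul_nonneg (ht0 x y) (sq_nonneg _)).trans
      (Finset.sum_le_sum_of_subset_of_nonneg hLK fun x _ _ => Finset.sum_nonneg
        fun y _ => mul_nonneg (ht0 x y) (sq_nonneg _))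
    simp_rw [mul_assoc α, ← Finset.mul_sum]
    linarith [mul_le_mul_of_nonneg_left h2 hα.le]
  · rw [Finset.mul_sum]
    refine (Finset.sum_le_sum fun x hx => ?_).trans
      (Finset.sum_le_sum_of_subset_of_nonneg hLK fun x _ _ => ?_)
    · rw [mul_left_comm, hrow]
      exact mul_le_mul_of_nonneg_left (hH.killing_le hα hT (hLK hx)) (sq_nonneg _)
    · rw [hrow]
      refine mul_nonneg hα.le (mul_nonneg (sq_nonneg _) ?_)
      have := (hH.dirichlet.resolvent_mem_Icc hα hT (trunc_one_mem_Icc (μ := μ) K) x).2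
      nlinarith [μ.pos x]

theorem sum_le_val (hH : IsMarkovianRealization G μ V H Q) (f : Q.domain) (L : Finset X) :
    1 / 2 * ∑ x ∈ L, ∑ y ∈ L, G.b x y * ((f : EllTwo μ) x - (f : EllTwo μ) y) ^ 2
      + ∑ x ∈ L, V x * (f : EllTwo μ) x ^ 2 * μ x ≤ Q.val f := by
  have hn := hH.dirichlet.nonneg
  obtain ⟨T, hT⟩ := hH.exists_resolvents
  have hp : ∀ n : ℕ, (0 : ℝ) < n + 1 := fun n => by positivity
  have h1 : ∀ n : ℕ, 1 / 2 * ∑ x ∈ L, ∑ y ∈ L, ((n : ℝ) + 1)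
          * inner ℝ (T n (delta μ x) : EllTwo μ) (delta μ y)
          * ((f : EllTwo μ) x - (f : EllTwo μ) y) ^ 2
      + ∑ x ∈ L, (f : EllTwo μ) x ^ 2 * ((∑' y, G.b x y) * ((T n (delta μ x) : EllTwo μ) x - 1)
        + V x * (T n (delta μ x) : EllTwo μ) x * μ x) ≤ Q.val f := by
    intro n
    refine le_trans ?_ ((hT n).mul_inner_le_val hn (hp n) f)
    have h2 := tendsto_trunc (f : EllTwo μ)
    have h3 := (((h2.sub (((hT n).continuous_coe hn (hp n)).tendsto _ |>.comp h2)).inner h2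
      (𝕜 := ℝ))).const_mul ((n : ℝ) + 1)
    refine ge_of_tendsto h3 ?_
    filter_upwards [eventually_ge_atTop L] with K hK
    exact hH.sum_le_mul_inner_trunc (hp n) (hT n) hK _
  have hlim := fun x => Q.tendsto_resolvent hH.dirichlet.closed hn hT
    ⟨delta μ x, hH.finSupp_le (delta_mem_finSupp x)⟩
  refine le_of_tendsto' (x := atTop) (Tendsto.add (Tendsto.const_mul _ (tendsto_finsetSum _ fun x _ =>
    tendsto_finsetSum _ fun y _ => ?_)) (tendsto_finsetSum _ fun x _ => ?_)) h1
  -- Diagonal terms vanish. Off the diagonal, `⟪δ_x, δ_y⟫ = 0` turns `α ⟪T δ_x, δ_y⟫` into `-Q(T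
  -- δ_x, δ_y)`, with limit `-Q(δ_x, δ_y) = b(x, y)`.
  · rcases eq_or_ne x y with rfl | hxy
    · simp
    refine Tendsto.mul_const _ ?_
    have h2 := Q.tendsto_form_of_tendsto_val hn (hlim x).2
      ⟨delta μ y, hH.finSupp_le (delta_mem_finSupp y)⟩
    have h3 : μ y * formalOp G μ V (delta μ x) y = -G.b x y := by
      rw [mul_formalOp, tsum_eq_single x, delta_of_ne hxy.symm, delta_self, G.symm y x]
      · ring
      · intro z hz
        rw [delta_of_ne hxy.symm, delta_of_ne hz]
        ring
    rw [hH.form_delta _ (delta_mem_Icc x), h3] at h2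
    have h4 := h2.neg
    rw [neg_neg] at h4
    refine h4.congr fun n => ?_
    rw [hT n, inner_sub_left, inner_delta (delta μ x), delta_of_ne hxy.symm]
    ring
  · have h2 := tendsto_apply (hlim x).1 x
    simp only [delta_self] at h2
    have h3 := (((h2.sub_const 1).const_mul (∑' y, G.b x y)).add
      ((h2.const_mul (V x)).mul_const (μ x))).const_mul ((f : EllTwo μ) x ^ 2)
    have h4 : (f : EllTwo μ) x ^ 2 * ((∑' y, G.b x y) * (1 - 1) + V x * 1 * μ x)
        = V x * (f : EllTwo μ) x ^ 2 * μ x := by ring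
    rwa [h4] at h3

theorem le_neumannForm (hH : IsMarkovianRealization G μ V H Q) : Q ≤ neumannForm G μ V := by
  classical
  have key : ∀ (f : Q.domain) (s : Finset (X × X)) (r : Finset X),
      1 / 2 * ∑ p ∈ s, G.b p.1 p.2 * ((f : EllTwo μ) p.1 - (f : EllTwo μ) p.2) ^ 2
        + ∑ x ∈ r, V x * (f : EllTwo μ) x ^ 2 * μ x ≤ Q.val f := by
    intro f s r
    -- The finite set is chosen so that its square contains `s` and it contains `r`; the added terms
    -- are nonnegative since `V ≥ 0`.
    refine le_trans ?_ (hH.sum_le_val f (s.image Prod.fst ∪ s.image Prod.snd ∪ r))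
    refine add_le_add (mul_le_mul_of_nonneg_left ?_ (by norm_num)) ?_
    · rw [← Finset.sum_product']
      refine Finset.sum_le_sum_of_subset_of_nonneg (fun p hp => ?_)
        fun p _ _ => mul_nonneg (G.nonneg _ _) (sq_nonneg _)
      rw [Finset.mem_product]
      exact ⟨Finset.mem_union_left _ (Finset.mem_union_left _ (Finset.mem_image_of_mem _ hp)),
        Finset.mem_union_left _ (Finset.mem_union_right _ (Finset.mem_image_of_mem _ hp))⟩
    · exact Finset.sum_le_sum_of_subset_of_nonneg Finset.subset_union_right
        fun x _ _ => mul_nonneg (mul_nonneg (hH.potential_nonneg x) (sq_nonneg _)) (μ.pos x).le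
  have hs : ∀ f : Q.domain, Summable fun p : X × X =>
      G.b p.1 p.2 * ((f : EllTwo μ) p.1 - (f : EllTwo μ) p.2) ^ 2 := fun f =>
    summable_of_sum_le (c := 2 * Q.val f) (fun p => mul_nonneg (G.nonneg _ _) (sq_nonneg _))
      fun s => by
        have := key f s ∅
        rw [Finset.sum_empty] at this
        linarith
  have hr : ∀ f : Q.domain, Summable fun x => V x * (f : EllTwo μ) x ^ 2 * μ x := fun f =>
    summable_of_sum_le (c := Q.val f)
      (fun x => mul_nonneg (mul_nonneg (hH.potential_nonneg x) (sq_nonneg _)) (μ.pos x).le)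
      fun r => by
        have := key f ∅ r
        rw [Finset.sum_empty] at this
        linarith
  refine ⟨fun f hf => ⟨hs ⟨f, hf⟩, (hr ⟨f, hf⟩).congr fun x => ?_⟩, fun f => ?_⟩
  · rw [abs_of_nonneg (hH.potential_nonneg x)]
  have h1 : 1 / 2 * ∑' p : X × X, G.b p.1 p.2 * ((f : EllTwo μ) p.1 - (f : EllTwo μ) p.2) ^ 2
      + ∑' x, V x * (f : EllTwo μ) x ^ 2 * μ x ≤ Q.val f := by
    -- The supremum over edge sets is taken first, with `r` fixed, and then the supremum over `r`.
    have h2 : ∀ r : Finset X, ∑ x ∈ r, V x * (f : EllTwo μ) x ^ 2 * μ x ≤ Q.val f - 1 / 2 *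
        ∑' p : X × X, G.b p.1 p.2 * ((f : EllTwo μ) p.1 - (f : EllTwo μ) p.2) ^ 2 := by
      intro r
      have h3 := (hs f).tsum_le_of_sum_le
        (a₂ := 2 * (Q.val f - ∑ x ∈ r, V x * (f : EllTwo μ) x ^ 2 * μ x))
        fun s => by linarith [key f s r]
      linarith
    linarith [(hr f).tsum_le_of_sum_le h2]
  refine le_of_eq_of_le ?_ h1
  change 1 / 2 * ∑' p : X × X, G.b p.1 p.2 * ((f : EllTwo μ) p.1 - (f : EllTwo μ) p.2)
      * ((f : EllTwo μ) p.1 - (f : EllTwo μ) p.2)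
    + ∑' x, V x * (f : EllTwo μ) x * (f : EllTwo μ) x * μ x = _
  simp only [sq, mul_assoc]

end IsMarkovianRealization

end DiscSchr
end

theorem mainTheorem10 {X : Type*} [Countable X] [Nonempty X]
    (G : DiscSchr.WeightedGraph X) (μ : DiscSchr.Weight X) (V : X → ℝ)
    (H : DiscSchr.EllTwo μ →ₗ.[ℝ] DiscSchr.EllTwo μ) (Q : DiscSchr.QForm (DiscSchr.EllTwo μ))
    (hH : DiscSchr.IsMarkovianRealization G μ V H Q) :
    (∀ x, 0 ≤ V x) ∧
    ∃ Q₀ : DiscSchr.QForm (DiscSchr.EllTwo μ),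
      Q₀.IsClosureOf (DiscSchr.compactForm G μ V) ∧
      Q₀ ≤ Q ∧ Q ≤ DiscSchr.neumannForm G μ V ∧ Q.Extends Q₀ := by
  obtain ⟨Q₀, h1, h2⟩ := Q.exists_isClosureOf (DiscSchr.compactForm G μ V) hH.dirichlet.closed
    hH.dirichlet.nonneg DiscSchr.EllTwo.dense_finSupp hH.extends_compactForm
  exact ⟨hH.potential_nonneg, Q₀, h1, ⟨h2.1, fun f => (h2.2 f).le⟩, hH.le_neumannForm, h2⟩
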